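/- Let $g\ge 0$, $T=(\mathbb C^\times)^g$, and let $\Gamma\subset T$ be a discrete subgroup isomorphic to $\mathbb Z^g$; put $X=T/\Gamma$. Let $\hat T=\operatorname{Hom}(T,\mathbb C^\times)\cong\mathbb Z^g$ be the group of monomials, $|T|=(\mathbb R_{>0})^g$, $\varpi\colon T\to|T|$, $(x_i)\mapsto(|x_i|)$, and $|X|=|T|/\Gamma$, with $\Gamma$ acting through $\varpi$. Let $\lambda\in Z^2(\hat T,U(1))$ be a 2-cocycle with values in the $N$-th roots of unity for some $N\ge1$. *The Laurent-series sheaf.* On a product of open intervals $D\subset|T|$, $\varpi_*\mathcal O_T(D)$ is the ring of absolutely convergent Laurent series $\sum_{t\in\hat T}a_t t$ on $\varpi^{-1}(D)$, and $$\Bigl(\sum_t a_t t\Bigr)\ast_\lambda\Bigl(\sum_t b_t t\Bigr)=\sum_t\Bigl(\sum_{t_1t_2=t}\lambda(t_1,t_2)a_{t_1}b_{t_2}\Bigr)t .$$ This gives a sheaf of associative $\mathbb C$-algebras $\mathcal O_{\mathsf T_\lambda}$ on $|T|$, on which $\gamma\in\Gamma$ acts by $\sum a_t t\mapsto\sum a_t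 t(\gamma)^{-1}t$ (over the translated open set). Let $\mathcal O_{\mathsf X_\lambda}$ be the sheaf of algebras on $|X|$ whose sections over $U$ are the $\Gamma$-invariant sections of $\mathcal O_{\mathsf T_\lambda}$ over the preimage of $U$ in $|T|$. *The finite description.* Let $\Lambda(t,t')=\lambda(t,t')\lambda(t',t)^{-1}$, $\hat H=\{t\in\hat T:\Lambda(t,t')=1\ \forall t'\in\hat T\}$, and $\hat K=\hat T/\hat H$, a finite group. Let $K=\{x\in T: t(x)=1\ \forall t\in\hat H\}$, which is the dual of $\hat K$, let $\pi\colon X\to Y=X/K$ be the quotient map, and let $\varpi_Y\colon Y\to|X|$ be the map such that $\varpi_Y\circ\pi\colon X\to|X|$ is induced by $\varpi$. Then $\pi_*\mathcal O_X=\bigoplus_{\hat k\in\hat K}\mathcal L_{\hat k}$, where $\mathcal L_{\hat k}$ consists of the functions on which $K$ acts through the character $\hat k$ (it is locally generated by a monomial representing $\hat k$). Fix a bilinear map $\bar\lambda\colon\hat K\times\hat K\to U(1)$ whose pullback to $\hat T$ is cohomologous to $\lambda$ in $Z^2(\hat T,U(1))$, and let $\mathcal O_{X_\lambda}$ be the sheaf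 of $\mathbb C$-algebras $(\pi_*\mathcal O_X,\star_\lambda)$ on $Y$, where $$(\phi_{\hat k})_{\hat k}\star_\lambda(\psi_{\hat k})_{\hat k}=\Bigl(\sum_{\hat k_1\hat k_2=\hat k}\bar\lambda(\hat k_1,\hat k_2)\,\phi_{\hat k_1}\psi_{\hat k_2}\Bigr)_{\hat k}.$$ Then there is an isomorphism $(\varpi_Y)_*\mathcal O_{X_\lambda}\cong\mathcal O_{\mathsf X_\lambda}$ of sheaves of $\mathbb C$-algebras on $|X|$. -/

import Mathlib

open TopologicalSpace CategoryTheory Opposite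

noncomputable section

namespace NCTorus

/-- The algebraic torus `T = (ℂˣ)^g`. -/
abbrev T (g : ℕ) : Type := Fin g → ℂˣ

/-- The character lattice of `T`, written additively: `t` stands for `x ↦ ∏ i, x i ^ t i`. -/
abbrev That (g : ℕ) : Type := Fin g → ℤ

/-- The real torus `|T| = (ℝ_{>0})^g`. -/
abbrev AbsT (g : ℕ) : Type := Fin g → {r : ℝ // 0 < r}

variable {g : ℕ}

/-- The monomial function attached to `t`. -/
def monomial (t : That g) : T g →* ℂˣ where
  toFun x := ∏ i, x i ^ t i
  map_one' := by simp
  map_mul' x y := by simp [mul_zpow, Finset.prod_mul_distrib]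

theorem monomial_zero : monomial (0 : That g) = 1 := by
  ext x; simp [monomial]

theorem monomial_add (s t : That g) : monomial (s + t) = monomial s * monomial t := by
  ext x; simp [monomial, zpow_add, Finset.prod_mul_distrib]

theorem monomial_single (i : Fin g) (x : T g) : monomial (Pi.single i 1) x = x i := by
  simp only [monomial, MonoidHom.coe_mk, OneHom.coe_mk]
  rw [Finset.prod_eq_single i]
  · simp
  · intro j _ hj; simp [Pi.single_eq_of_ne hj]
  · simp

/-- The value of the monomial `t` at a point of `|T|`. -/
def absMonomial (t : That g) (r : AbsT g) : ℝ := ∏ i, (r i : ℝ) ^ t i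

theorem absMonomial_pos (t : That g) (r : AbsT g) : 0 < absMonomial t r :=
  Finset.prod_pos fun i _ => zpow_pos (r i).2 _

theorem absMonomial_zero (r : AbsT g) : absMonomial 0 r = 1 := by simp [absMonomial]

theorem absMonomial_add (s t : That g) (r : AbsT g) :
    absMonomial (s + t) r = absMonomial s r * absMonomial t r := by
  simp only [absMonomial, Pi.add_apply, ← Finset.prod_mul_distrib]
  exact Finset.prod_congr rfl fun i _ => zpow_add₀ (r i).2.ne' _ _

/-- The map `ϖ : T → |T|`, `(x_i) ↦ (|x_i|)`. -/
def varpi (g : ℕ) : T g →* AbsT g where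
  toFun x i := ⟨‖(x i : ℂ)‖, norm_pos_iff.2 (x i).ne_zero⟩
  map_one' := by ext i; simp
  map_mul' x y := by ext i; simp

theorem continuous_varpi (g : ℕ) : Continuous (varpi g) :=
  continuous_pi fun i => Continuous.subtype_mk
    (continuous_norm.comp (Units.continuous_val.comp (continuous_apply i))) _

/-! ### Deformation parameters -/

/-- A unitary deformation parameter: a `U(1)`-valued 2-cocycle on the character lattice. -/
structure UnitaryParameter (g : ℕ) where
  toFun : That g → That g → Circle
  cocycle : ∀ t₁ t₂ t₃ : That g,
    toFun t₂ t₃ * (toFun (t₁ + t₂) t₃)⁻¹ * toFun t₁ (t₂ + t₃) * (toFun t₁ t₂)⁻¹ = 1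

namespace UnitaryParameter

instance : CoeFun (UnitaryParameter g) fun _ => That g → That g → Circle := ⟨toFun⟩

theorem cocycle' (lam : UnitaryParameter g) (a b c : That g) :
    lam b c * lam a (b + c) = lam (a + b) c * lam a b := by
  have h := lam.cocycle a b c
  calc lam b c * lam a (b + c)
      = (lam b c * (lam (a + b) c)⁻¹ * lam a (b + c) * (lam a b)⁻¹)
          * (lam (a + b) c * lam a b) := by
        simp only [mul_comm, mul_left_comm, mul_assoc]; simp
    _ = _ := by rw [h, one_mul]

theorem zero_left (lam : UnitaryParameter g) (t : That g) : lam 0 t = lam 0 0 := by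
  simpa using lam.cocycle' 0 0 t

theorem zero_right (lam : UnitaryParameter g) (t : That g) : lam t 0 = lam 0 0 := by
  have := lam.cocycle' t 0 0
  simpa using this.symm

/-- The parameter takes values in `μ_N` for some positive integer `N`. -/
class IsTorsion (lam : UnitaryParameter g) : Prop where
  out : ∃ N : ℕ, 0 < N ∧ ∀ s t : That g, lam s t ^ N = 1

/-- The value `Λ(s ∧ t) = λ(s,t) λ(t,s)⁻¹` of the alternating bimultiplicative form
corresponding to the class of `λ` in `H²`. -/
def alt (lam : UnitaryParameter g) (s t : That g) : Circle := lam s t * (lam t s)⁻¹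

theorem alt_add_left (lam : UnitaryParameter g) (a b c : That g) :
    lam.alt (a + b) c = lam.alt a c * lam.alt b c := by
  have h1 := lam.cocycle' a b c
  have h2 := lam.cocycle' c a b
  have h3 := lam.cocycle' a c b
  rw [add_comm c a] at h2
  rw [add_comm c b] at h3
  simp only [alt, ← div_eq_mul_inv]
  have e1 : lam (a + b) c = lam b c * lam a (b + c) / lam a b := by rw [h1, mul_div_cancel_right]
  have e2 : lam c (a + b) = lam (a + c) b * lam c a / lam a b := by
    rw [← h2, mul_div_cancel_left]
  have e3 : lam a (b + c) = lam (a + c) b * lam a c / lam c b := by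
    rw [← h3, mul_div_cancel_left]
  rw [e1, e2, e3]
  simp only [div_eq_mul_inv, mul_inv, inv_inv]
  have : ∀ p q r s u v : Circle, p * (q * r * s⁻¹) * u⁻¹ * (q⁻¹ * v⁻¹ * u)
      = r * v⁻¹ * (p * s⁻¹) := by
    intro p q r s u v
    ext
    have := Circle.coe_ne_zero
    push_cast
    field_simp
  exact this _ _ _ _ _ _

theorem alt_zero_left (lam : UnitaryParameter g) (c : That g) : lam.alt 0 c = 1 := by
  simp [alt, zero_left, zero_right]

/-- The subgroup `Ĥ` of the character lattice, the kernel of `Λ`. -/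
def Hhat (lam : UnitaryParameter g) : AddSubgroup (That g) where
  carrier := {t | ∀ t' : That g, lam.alt t t' = 1}
  zero_mem' := lam.alt_zero_left
  add_mem' ha hb t' := by rw [alt_add_left, ha t', hb t', one_mul]
  neg_mem' {a} ha t' := by
    have := lam.alt_add_left (-a) a t'
    rw [neg_add_cancel, alt_zero_left, ha t', mul_one] at this
    exact this.symm

/-- The quotient `K̂ = T̂ / Ĥ`. -/
abbrev Khat (lam : UnitaryParameter g) : Type := That g ⧸ lam.Hhat

theorem exists_nsmul_mem (lam : UnitaryParameter g) [h : lam.IsTorsion] :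
    ∃ N : ℕ, 0 < N ∧ ∀ t : That g, N • t ∈ lam.Hhat := by
  obtain ⟨N, hN, hl⟩ := h.out
  refine ⟨N, hN, fun t t' => ?_⟩
  have : ∀ n : ℕ, lam.alt (n • t) t' = lam.alt t t' ^ n := by
    intro n
    induction n with
    | zero => simp [alt_zero_left]
    | succ n ih => rw [succ_nsmul, alt_add_left, ih, pow_succ]
  rw [this, alt, mul_pow, inv_pow, hl, hl]; simp

instance finite_Khat (lam : UnitaryParameter g) [lam.IsTorsion] : Finite lam.Khat := by
  obtain ⟨N, hN, h⟩ := lam.exists_nsmul_mem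
  have : Module.Finite ℤ lam.Khat :=
    Module.Finite.of_surjective (QuotientAddGroup.mk' lam.Hhat).toIntLinearMap
      (QuotientAddGroup.mk'_surjective _)
  refine Module.finite_of_fg_torsion _ ?_
  intro x
  obtain ⟨t, rfl⟩ := QuotientAddGroup.mk_surjective x
  refine ⟨⟨(N : ℤ), mem_nonZeroDivisors_of_ne_zero (by exact_mod_cast hN.ne')⟩, ?_⟩
  have := h t
  change (N : ℤ) • (t : lam.Khat) = 0
  rw [natCast_zsmul, ← QuotientAddGroup.mk_nsmul]
  exact (QuotientAddGroup.eq_zero_iff _).2 this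

/-- The subgroup `K` of `T`, the kernel of the map `T → H` dual to the inclusion `Ĥ → T̂`. -/
def K (lam : UnitaryParameter g) : Subgroup (T g) where
  carrier := {x | ∀ t ∈ lam.Hhat, monomial t x = 1}
  one_mem' t _ := map_one _
  mul_mem' ha hb t ht := by rw [map_mul, ha t ht, hb t ht, one_mul]
  inv_mem' ha t ht := by rw [map_inv, ha t ht, inv_one]

/-- The duality pairing between `K̂` and `K`, induced by evaluation of monomials. -/
def pairing (lam : UnitaryParameter g) : lam.Khat →+ Additive (lam.K →* ℂˣ) :=
  QuotientAddGroup.lift lam.Hhat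
    { toFun := fun t => Additive.ofMul ((monomial t).comp lam.K.subtype)
      map_zero' := by rw [monomial_zero]; rfl
      map_add' := fun s t => by rw [monomial_add]; rfl }
    (fun t ht => by
      change Additive.ofMul _ = 0
      rw [ofMul_eq_zero]
      ext κ
      simp [κ.2 t ht])

/-- The value of the character `k` of `K` at `κ`. -/
def chr (lam : UnitaryParameter g) (k : lam.Khat) (κ : lam.K) : ℂˣ :=
  (lam.pairing k).toMul κ

variable (lam : UnitaryParameter g)

theorem chr_mk (t : That g) (κ : lam.K) : lam.chr (t : lam.Khat) κ = monomial t (κ : T g) := rfl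

theorem chr_zero (κ : lam.K) : lam.chr 0 κ = 1 := by simp [chr]

theorem chr_add (k l : lam.Khat) (κ : lam.K) : lam.chr (k + l) κ = lam.chr k κ * lam.chr l κ := by
  simp [chr]

theorem chr_one (k : lam.Khat) : lam.chr k 1 = 1 := by simp [chr]

theorem chr_mul (k : lam.Khat) (κ κ' : lam.K) :
    lam.chr k (κ * κ') = lam.chr k κ * lam.chr k κ' := by simp [chr]

/-- The point of `T` defined by a character of `K̂`. -/
def ofChar (ψ : AddChar lam.Khat ℂ) : T g := fun i =>
  (AddChar.toMonoidHom ψ).toHomUnits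
    (Multiplicative.ofAdd ((Pi.single i 1 : That g) : lam.Khat))

theorem monomial_ofChar (ψ : AddChar lam.Khat ℂ) (t : That g) :
    monomial t (lam.ofChar ψ) =
      (AddChar.toMonoidHom ψ).toHomUnits (Multiplicative.ofAdd (t : lam.Khat)) := by
  have ht : t = ∑ i, t i • (Pi.single i 1 : That g) := by
    ext j; simp [Pi.single_apply]
  conv_rhs => rw [ht]
  have h2 : ((∑ i, t i • (Pi.single i 1 : That g) : That g) : lam.Khat)
      = ∑ i, t i • ((Pi.single i 1 : That g) : lam.Khat) :=
    map_sum (QuotientAddGroup.mk' lam.Hhat)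
      (fun i => t i • (Pi.single i 1 : That g)) Finset.univ
  rw [h2, ofAdd_sum, map_prod]
  simp [monomial, ofChar, ofAdd_zsmul]

/-- `K` is the group of all characters of `K̂`. -/
def KEquiv : lam.K ≃ AddChar lam.Khat ℂ where
  toFun κ :=
    { toFun := fun k => (lam.chr k κ : ℂ)
      map_zero_eq_one' := by simp [chr_zero]
      map_add_eq_mul' := fun k l => by simp [chr_add] }
  invFun ψ := ⟨lam.ofChar ψ, fun t ht => by
      rw [monomial_ofChar, (QuotientAddGroup.eq_zero_iff t).2 ht]
      simp⟩
  left_inv κ := by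
    apply Subtype.ext
    funext i
    ext
    change (lam.chr ((Pi.single i 1 : That g) : lam.Khat) κ : ℂ) = _
    rw [chr_mk, monomial_single]
  right_inv ψ := by
    ext k
    obtain ⟨t, rfl⟩ := QuotientAddGroup.mk_surjective k
    change (lam.chr (t : lam.Khat) _ : ℂ) = _
    rw [chr_mk, monomial_ofChar]
    rfl

theorem KEquiv_apply (κ : lam.K) (k : lam.Khat) : lam.KEquiv κ k = (lam.chr k κ : ℂ) := rfl

variable [lam.IsTorsion]

instance fintypeKhat : Fintype lam.Khat := Fintype.ofFinite _

instance fintypeK : Fintype lam.K :=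
  have : Finite lam.K := Finite.of_equiv _ lam.KEquiv.symm
  Fintype.ofFinite _

theorem card_K : Fintype.card lam.K = Fintype.card lam.Khat := by
  rw [Fintype.card_congr lam.KEquiv, ← AddChar.card_eq (α := lam.Khat)]

theorem card_K_ne_zero : (Fintype.card lam.K : ℂ) ≠ 0 := by
  exact_mod_cast Fintype.card_ne_zero

open Classical in
theorem sum_chr_left (κ : lam.K) :
    ∑ k : lam.Khat, (lam.chr k κ : ℂ) = if κ = 1 then (Fintype.card lam.K : ℂ) else 0 := by
  have h1 : lam.KEquiv 1 = 0 := by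
    ext k; simp [KEquiv_apply, chr_one]
  have := AddChar.sum_eq_ite (lam.KEquiv κ)
  simp only [KEquiv_apply] at this
  rw [this, card_K]
  congr 1
  rw [← h1, lam.KEquiv.apply_eq_iff_eq]

open Classical in
theorem sum_chr_right (k : lam.Khat) :
    ∑ κ : lam.K, (lam.chr k κ : ℂ) = if k = 0 then (Fintype.card lam.K : ℂ) else 0 := by
  have := AddChar.sum_apply_eq_ite k
  rw [card_K, ← this, ← lam.KEquiv.sum_comp]
  simp only [KEquiv_apply]

theorem varpi_eq_one {x : T g} (hx : x ∈ lam.K) : varpi g x = 1 := by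
  obtain ⟨N, hN, h⟩ := lam.exists_nsmul_mem
  ext i
  have h1 := hx _ (h (Pi.single i 1))
  have h2 : x i ^ N = 1 := by
    have h3 : ∀ n : ℕ, monomial (n • (Pi.single i 1 : That g)) x = x i ^ n := by
      intro n
      induction n with
      | zero => simp [monomial_zero]
      | succ n ih => rw [succ_nsmul, monomial_add, MonoidHom.mul_apply, ih, monomial_single,
          pow_succ]
    rw [← h3, h1]
  have h3 : (x i : ℂ) ^ N = 1 := by rw [← Units.val_pow_eq_pow_val, h2, Units.val_one]
  exact Complex.norm_eq_one_of_pow_eq_one h3 hN.ne'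

end UnitaryParameter

/-! ### Complex tori -/

/-- The complex torus `X = T / Γ`. -/
def X (Γ : Subgroup (T g)) : Type := T g ⧸ Γ

instance (Γ : Subgroup (T g)) : CommGroup (X Γ) := inferInstanceAs (CommGroup (T g ⧸ Γ))

instance (Γ : Subgroup (T g)) : TopologicalSpace (X Γ) :=
  inferInstanceAs (TopologicalSpace (T g ⧸ Γ))

/-- The quotient map `T → X`. -/
def toX (Γ : Subgroup (T g)) : T g →* X Γ := QuotientGroup.mk' Γ

/-- The image of `K` in `X`. -/
def KX (Γ : Subgroup (T g)) (lam : UnitaryParameter g) : Subgroup (X Γ) :=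
  lam.K.map (toX Γ)

/-- The complex torus `Y = X / K`. -/
def Y (Γ : Subgroup (T g)) (lam : UnitaryParameter g) : Type := X Γ ⧸ KX Γ lam

instance (Γ : Subgroup (T g)) (lam : UnitaryParameter g) : CommGroup (Y Γ lam) :=
  inferInstanceAs (CommGroup (X Γ ⧸ KX Γ lam))

instance (Γ : Subgroup (T g)) (lam : UnitaryParameter g) : TopologicalSpace (Y Γ lam) :=
  inferInstanceAs (TopologicalSpace (X Γ ⧸ KX Γ lam))

/-- The real torus `|X| = |T| / Γ`, where `Γ` acts through `ϖ`. -/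
def AbsX (Γ : Subgroup (T g)) : Type := AbsT g ⧸ Γ.map (varpi g)

instance (Γ : Subgroup (T g)) : CommGroup (AbsX Γ) :=
  inferInstanceAs (CommGroup (AbsT g ⧸ Γ.map (varpi g)))

instance (Γ : Subgroup (T g)) : TopologicalSpace (AbsX Γ) :=
  inferInstanceAs (TopologicalSpace (AbsT g ⧸ Γ.map (varpi g)))

/-- The quotient map `π : X → Y`. -/
def piXY (Γ : Subgroup (T g)) (lam : UnitaryParameter g) : X Γ →* Y Γ lam :=
  QuotientGroup.mk' (KX Γ lam)

/-- The quotient map `|T| → |X|`. -/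
def toAbsX (Γ : Subgroup (T g)) : AbsT g →* AbsX Γ := QuotientGroup.mk' (Γ.map (varpi g))

/-- The map `ϖ_X : X → |X|` induced by `ϖ`. -/
def varpiX (Γ : Subgroup (T g)) : X Γ →* AbsX Γ :=
  QuotientGroup.map Γ (Γ.map (varpi g)) (varpi g) (Subgroup.le_comap_map _ _)

/-- The map `ϖ_Y : Y → |X|` with `ϖ_Y ∘ π = ϖ_X`. -/
def varpiY (Γ : Subgroup (T g)) (lam : UnitaryParameter g) [lam.IsTorsion] : Y Γ lam →* AbsX Γ :=
  QuotientGroup.lift (KX Γ lam) (varpiX Γ) (by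
    rintro _ ⟨x, hx, rfl⟩
    change toAbsX Γ (varpi g x) = 1
    rw [lam.varpi_eq_one hx, map_one])

section
variable (Γ : Subgroup (T g)) (lam : UnitaryParameter g)

theorem continuous_toX : Continuous (toX Γ) := continuous_quot_mk

theorem continuous_piXY : Continuous (piXY Γ lam) := continuous_quot_mk

theorem continuous_toAbsX : Continuous (toAbsX Γ) := continuous_quot_mk

theorem continuous_varpiX : Continuous (varpiX Γ) :=
  Continuous.quotient_lift ((continuous_toAbsX Γ).comp (continuous_varpi g)) _

theorem varpiY_comp_piXY [lam.IsTorsion] (x : X Γ) : varpiY Γ lam (piXY Γ lam x) = varpiX Γ x := rfl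

theorem continuous_varpiY [lam.IsTorsion] : Continuous (varpiY Γ lam) :=
  Continuous.quotient_lift (continuous_varpiX Γ) _

end

/-! ### Holomorphic functions -/

/-- The coordinate embedding of `T` into `ℂ^g`. -/
def coord (x : T g) : Fin g → ℂ := fun i => (x i : ℂ)

theorem coord_injective : Function.Injective (coord (g := g)) := fun _ _ h =>
  funext fun i => Units.ext (congrFun h i)

theorem isOpenEmbedding_coord : Topology.IsOpenEmbedding (coord (g := g)) := by
  have := Topology.IsOpenEmbedding.piMap (fun _ : Fin g => Units.isOpenEmbedding_val (R := ℂ))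
  exact this

/-- A complex valued function on a subset `S` of `T` is holomorphic if, in the coordinates of
`ℂ^g`, it is given by a complex differentiable function. -/
def IsHolomorphic {S : Set (T g)} (f : S → ℂ) : Prop :=
  ∃ F : (Fin g → ℂ) → ℂ, DifferentiableOn ℂ F (coord '' S) ∧ ∀ x : S, f x = F (coord (x : T g))

theorem isHolomorphic_of_local {S : Set (T g)} (f : S → ℂ)
    (h : ∀ x ∈ S, ∃ S' : Set (T g), IsOpen S' ∧ x ∈ S' ∧ ∃ hS : S' ⊆ S,
      IsHolomorphic fun y : S' => f ⟨y, hS y.2⟩) : IsHolomorphic f := by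
  have hinj : Function.Injective fun x : S => coord (x : T g) :=
    coord_injective.comp Subtype.val_injective
  refine ⟨Function.extend (fun x : S => coord (x : T g)) f 0, ?_, fun x =>
    (hinj.extend_apply f 0 x).symm⟩
  rintro _ ⟨x, hx, rfl⟩
  obtain ⟨S', hS', hxS', hS, F, hF, hfF⟩ := h x hx
  have ho : IsOpen (coord '' S') := isOpenEmbedding_coord.isOpenMap _ hS'
  have hm : coord '' S' ∈ nhds (coord x) := ho.mem_nhds ⟨x, hxS', rfl⟩
  have : DifferentiableAt ℂ F (coord x) := (hF _ ⟨x, hxS', rfl⟩).differentiableAt hm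
  refine (this.congr_of_eventuallyEq ?_).differentiableWithinAt
  filter_upwards [hm]
  rintro _ ⟨y, hy, rfl⟩
  have := hinj.extend_apply f 0 ⟨y, hS hy⟩
  rw [this]
  exact hfF ⟨y, hy⟩

theorem IsHolomorphic.mono {S S' : Set (T g)} (hS : S' ⊆ S) {f : S → ℂ} (hf : IsHolomorphic f) :
    IsHolomorphic fun y : S' => f ⟨y, hS y.2⟩ := by
  obtain ⟨F, hF, h⟩ := hf
  exact ⟨F, hF.mono (Set.image_mono hS), fun x => h _⟩

theorem IsHolomorphic.translate {S S' : Set (T g)} (a : T g) (hS : ∀ x ∈ S', x * a ∈ S) {f : S → ℂ}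
    (hf : IsHolomorphic f) : IsHolomorphic fun y : S' => f ⟨y * a, hS y y.2⟩ := by
  obtain ⟨F, hF, h⟩ := hf
  refine ⟨fun z => F (z * coord a), ?_, fun x => h _⟩
  refine hF.comp (by fun_prop) ?_
  rintro _ ⟨x, hx, rfl⟩
  exact ⟨x * a, hS x hx, rfl⟩

variable (Γ : Subgroup (T g))

/-- The structure sheaf of the complex torus `X`: the algebra of holomorphic functions on an open
subset `W` of `X = T / Γ`, i.e. functions on `W` whose pullback to `T` is holomorphic. -/
def OX (W : Opens (X Γ)) : Subalgebra ℂ (W → ℂ) where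
  carrier := {f | IsHolomorphic (S := toX Γ ⁻¹' W) fun x => f ⟨toX Γ x, x.2⟩}
  mul_mem' := by
    rintro a b ⟨F, hF, hf⟩ ⟨G, hG, hg⟩
    exact ⟨F * G, hF.mul hG, fun x => congrArg₂ (· * ·) (hf x) (hg x)⟩
  add_mem' := by
    rintro a b ⟨F, hF, hf⟩ ⟨G, hG, hg⟩
    exact ⟨F + G, hF.add hG, fun x => congrArg₂ (· + ·) (hf x) (hg x)⟩
  algebraMap_mem' c := ⟨fun _ => c, differentiableOn_const _, fun _ => rfl⟩

section
variable {Γ}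

/-- The preimage under `π` of an open subset of `Y`. -/
def piPre (lam : UnitaryParameter g) (V : Opens (Y Γ lam)) : Opens (X Γ) :=
  ⟨piXY Γ lam ⁻¹' V, V.2.preimage (continuous_piXY Γ lam)⟩

theorem mul_mem_piPre {lam : UnitaryParameter g} {V : Opens (Y Γ lam)} {x : X Γ}
    (hx : x ∈ piPre lam V) (κ : lam.K) : x * toX Γ κ ∈ piPre lam V := by
  change piXY Γ lam (x * toX Γ κ) ∈ V
  have : piXY Γ lam (toX Γ κ) = 1 :=
    (QuotientGroup.eq_one_iff _).2 ⟨κ, κ.2, rfl⟩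
  rw [map_mul, this, mul_one]
  exact hx

variable (lam : UnitaryParameter g) (V : Opens (Y Γ lam))

/-- The translation `f ↦ f(· κ)` by an element `κ` of `K` on the sections of `π_* 𝒪_X` over `V`. -/
def translate (κ : lam.K) : OX Γ (piPre lam V) →ₐ[ℂ] OX Γ (piPre lam V) where
  toFun f := ⟨fun x => f.1 ⟨x * toX Γ κ, mul_mem_piPre x.2 κ⟩,
    IsHolomorphic.translate (κ : T g) (S := toX Γ ⁻¹' (piPre lam V)) (S' := toX Γ ⁻¹' (piPre lam V))
      (f := fun x => f.1 ⟨toX Γ x, x.2⟩)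
      (fun x hx => by
        change toX Γ (x * κ) ∈ piPre lam V
        rw [map_mul]; exact mul_mem_piPre hx κ) f.2⟩
  map_one' := rfl
  map_mul' _ _ := rfl
  map_zero' := rfl
  map_add' _ _ := rfl
  commutes' _ := rfl

theorem translate_one (f : OX Γ (piPre lam V)) : translate lam V 1 f = f := by
  apply Subtype.ext
  funext x
  exact congrArg f.1 (Subtype.ext (by simp))

theorem translate_mul (κ κ' : lam.K) (f : OX Γ (piPre lam V)) :
    translate lam V κ (translate lam V κ' f) = translate lam V (κ * κ') f := by
  apply Subtype.ext
  funext x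
  exact congrArg f.1 (Subtype.ext (by simp [mul_assoc]))

/-- The sections over `V` of the line bundle `L_k` on `Y`, as a subsheaf of `π_* 𝒪_X`:
functions on which `K` acts through the character `k`; locally these are the multiples
of a monomial representing `k` by functions pulled back from `Y`. -/
def L (k : lam.Khat) : Submodule ℂ (OX Γ (piPre lam V)) where
  carrier := {f | ∀ κ : lam.K, translate lam V κ f = (lam.chr k κ : ℂ) • f}
  zero_mem' κ := by simp
  add_mem' ha hb κ := by rw [map_add, ha κ, hb κ, smul_add]
  smul_mem' c f hf κ := by rw [map_smul, hf κ, smul_comm]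

theorem mul_mem_L {k l : lam.Khat} {f h : OX Γ (piPre lam V)} (hf : f ∈ L lam V k)
    (hh : h ∈ L lam V l) : f * h ∈ L lam V (k + l) := by
  intro κ
  rw [map_mul, hf κ, hh κ, UnitaryParameter.chr_add, smul_mul_smul_comm, Units.val_mul]

theorem chr_neg (k : lam.Khat) (κ : lam.K) : lam.chr (-k) κ = (lam.chr k κ)⁻¹ := by
  simp [UnitaryParameter.chr]

theorem chr_inv (k : lam.Khat) (κ : lam.K) : lam.chr k κ⁻¹ = (lam.chr k κ)⁻¹ := by
  simp [UnitaryParameter.chr]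

theorem one_mem_L : (1 : OX Γ (piPre lam V)) ∈ L lam V 0 := by
  intro κ
  rw [map_one, UnitaryParameter.chr_zero, Units.val_one, one_smul]

theorem piPre_mono {V V' : Opens (Y Γ lam)} (h : V' ≤ V) : piPre lam V' ≤ piPre lam V :=
  fun _ hx => h hx

variable [lam.IsTorsion]

/-- The projection of `π_* 𝒪_X` onto the summand `L_k`, by averaging over `K`. -/
def proj (k : lam.Khat) : OX Γ (piPre lam V) →ₗ[ℂ] OX Γ (piPre lam V) :=
  (Fintype.card lam.K : ℂ)⁻¹ •
    ∑ κ : lam.K, ((lam.chr k κ)⁻¹ : ℂˣ).val • (translate lam V κ).toLinearMap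

theorem proj_apply (k : lam.Khat) (f : OX Γ (piPre lam V)) :
    proj lam V k f = (Fintype.card lam.K : ℂ)⁻¹ •
      ∑ κ : lam.K, ((lam.chr k κ)⁻¹ : ℂˣ).val • translate lam V κ f := by
  simp [proj, LinearMap.sum_apply]

theorem proj_mem (k : lam.Khat) (f : OX Γ (piPre lam V)) : proj lam V k f ∈ L lam V k := by
  intro κ
  rw [proj_apply, map_smul, map_sum, smul_comm (_ : ℂ) (_ : ℂ)]
  congr 1
  rw [Finset.smul_sum]
  refine Fintype.sum_equiv (Equiv.mulLeft κ) _ _ fun κ' => ?_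
  rw [map_smul, translate_mul, smul_smul, Equiv.coe_mulLeft, ← Units.val_mul,
    UnitaryParameter.chr_mul, mul_inv, mul_inv_cancel_left]

open Classical in
theorem proj_of_mem {k l : lam.Khat} {f : OX Γ (piPre lam V)} (hf : f ∈ L lam V l) :
    proj lam V k f = if k = l then f else 0 := by
  rw [proj_apply]
  have : ∀ κ : lam.K, ((lam.chr k κ)⁻¹ : ℂˣ).val • translate lam V κ f
      = (lam.chr (l - k) κ : ℂ) • f := by
    intro κ
    rw [hf κ, smul_smul, sub_eq_add_neg, UnitaryParameter.chr_add, chr_neg, ← Units.val_mul,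
      mul_comm]
  simp only [this]
  rw [← Finset.sum_smul, UnitaryParameter.sum_chr_right]
  by_cases h : k = l
  · subst h
    simp [smul_smul, lam.card_K_ne_zero]
  · have : l - k ≠ 0 := sub_ne_zero.2 (Ne.symm h)
    simp [this, h]

theorem sum_proj (f : OX Γ (piPre lam V)) : ∑ k : lam.Khat, proj lam V k f = f := by
  classical
  simp only [proj_apply]
  rw [← Finset.smul_sum, Finset.sum_comm]
  have : ∀ κ : lam.K, ∑ k : lam.Khat, ((lam.chr k κ)⁻¹ : ℂˣ).val • translate lam V κ f
      = if κ = 1 then (Fintype.card lam.K : ℂ) • f else 0 := by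
    intro κ
    rw [← Finset.sum_smul]
    have h := lam.sum_chr_left κ⁻¹
    simp only [chr_inv, inv_eq_one] at h
    rw [h]
    split_ifs with hκ
    · rw [hκ, translate_one]
    · simp
  rw [Finset.sum_congr rfl fun κ _ => this κ]
  simp [smul_smul, lam.card_K_ne_zero]

instance (k : lam.Khat) : AddCommGroup (L lam V k) := Submodule.addCommGroup _

open Classical in
/-- The decomposition `π_* 𝒪_X = ⨁_k L_k`. -/
theorem isInternal_L : DirectSum.IsInternal (fun k : lam.Khat => L lam V k) := by
  constructor
  · intro x y hxy
    ext k
    have key : ∀ x : DirectSum lam.Khat (fun k => L lam V k),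
        proj lam V k (DirectSum.coeAddMonoidHom (fun k => L lam V k) x) = x k := by
      intro x
      induction x using DirectSum.induction_on with
      | zero => simp
      | of l x =>
        rw [DirectSum.coeAddMonoidHom_of, proj_of_mem lam V x.2]
        split_ifs with h
        · subst h; simp
        · rw [DirectSum.of_eq_of_ne _ _ _ h]; rfl
      | add x y hx hy => rw [map_add, map_add, hx, hy]; rfl
    rw [← key x, ← key y, hxy]
  · intro f
    refine ⟨∑ k, DirectSum.of (fun k => L lam V k) k ⟨proj lam V k f, proj_mem lam V k f⟩, ?_⟩
    rw [map_sum]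
    simp only [DirectSum.coeAddMonoidHom_of]
    exact sum_proj lam V f

end

/-! ### The star product at roots of unity -/

/-- A bilinear map `K̂ ⊗ K̂ → U(1)` representing the cohomology class of `λ`. -/
structure BilinearRep (lam : UnitaryParameter g) where
  toHom : lam.Khat →+ lam.Khat →+ Additive Circle
  represents : ∃ α : That g → Circle, ∀ s t : That g,
    lam s t = (toHom s t).toMul * α s * α t * (α (s + t))⁻¹

/-- The complex number `λ(k,l)`. -/
def BilinearRep.val {lam : UnitaryParameter g} (b : BilinearRep lam) (k l : lam.Khat) : ℂ :=
  ((b.toHom k l).toMul : Circle)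

section
variable {Γ}
variable {lam : UnitaryParameter g} (b : BilinearRep lam)

theorem BilinearRep.val_add_left (k k' l : lam.Khat) :
    b.val (k + k') l = b.val k l * b.val k' l := by simp [BilinearRep.val]

theorem BilinearRep.val_add_right (k l l' : lam.Khat) :
    b.val k (l + l') = b.val k l * b.val k l' := by simp [BilinearRep.val]

theorem BilinearRep.val_zero_left (l : lam.Khat) : b.val 0 l = 1 := by simp [BilinearRep.val]

theorem BilinearRep.val_zero_right (l : lam.Khat) : b.val l 0 = 1 := by simp [BilinearRep.val]

variable [lam.IsTorsion] (V : Opens (Y Γ lam))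

/-- The star product on `π_* 𝒪_X = ⨁_k L_k`: the component of index `k` of the product is
`∑_{k₁ + k₂ = k} λ(k₁,k₂) φ_{k₁} ψ_{k₂}`. -/
def star : OX Γ (piPre lam V) →ₗ[ℂ] OX Γ (piPre lam V) →ₗ[ℂ] OX Γ (piPre lam V) :=
  ∑ k₁ : lam.Khat, ∑ k₂ : lam.Khat,
    b.val k₁ k₂ • (LinearMap.mul ℂ (OX Γ (piPre lam V))).compl₁₂ (proj lam V k₁) (proj lam V k₂)

theorem star_apply (φ ψ : OX Γ (piPre lam V)) :
    star b V φ ψ = ∑ k₁ : lam.Khat, ∑ k₂ : lam.Khat,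
      b.val k₁ k₂ • (proj lam V k₁ φ * proj lam V k₂ ψ) := by
  simp [star, LinearMap.sum_apply]

theorem star_of_mem {k l : lam.Khat} {φ ψ : OX Γ (piPre lam V)} (hφ : φ ∈ L lam V k)
    (hψ : ψ ∈ L lam V l) : star b V φ ψ = b.val k l • (φ * ψ) := by
  classical
  rw [star_apply]
  simp only [proj_of_mem lam V hφ, proj_of_mem lam V hψ]
  rw [Finset.sum_eq_single k, Finset.sum_eq_single l]
  · simp
  · intro x _ hx; simp [hx]
  · simp
  · intro x _ hx; simp [hx]
  · simp

theorem proj_star (k : lam.Khat) (φ ψ : OX Γ (piPre lam V)) :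
    proj lam V k (star b V φ ψ) = ∑ k₁ : lam.Khat,
      b.val k₁ (k - k₁) • (proj lam V k₁ φ * proj lam V (k - k₁) ψ) := by
  classical
  simp only [star_apply, map_sum, map_smul]
  refine Finset.sum_congr rfl fun k₁ _ => ?_
  rw [Finset.sum_eq_single (k - k₁)]
  · rw [proj_of_mem lam V (mul_mem_L lam V (proj_mem lam V _ _) (proj_mem lam V _ _)),
      if_pos (by abel)]
  · intro k₂ _ h
    rw [proj_of_mem lam V (mul_mem_L lam V (proj_mem lam V _ _) (proj_mem lam V _ _)),
      if_neg (fun h' => h (by rw [h']; abel)), smul_zero]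
  · simp

theorem star_assoc (φ ψ χ : OX Γ (piPre lam V)) :
    star b V (star b V φ ψ) χ = star b V φ (star b V ψ χ) := by
  have key : ∀ k l m : lam.Khat,
      star b V (star b V (proj lam V k φ) (proj lam V l ψ)) (proj lam V m χ) =
        star b V (proj lam V k φ) (star b V (proj lam V l ψ) (proj lam V m χ)) := by
    intro k l m
    have h1 := proj_mem lam V k φ
    have h2 := proj_mem lam V l ψ
    have h3 := proj_mem lam V m χ
    rw [star_of_mem b V h1 h2, star_of_mem b V h2 h3, map_smul, map_smul, LinearMap.smul_apply,
      star_of_mem b V (mul_mem_L lam V h1 h2) h3, star_of_mem b V h1 (mul_mem_L lam V h2 h3),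
      smul_smul, smul_smul, mul_assoc, b.val_add_left, b.val_add_right]
    congr 1
    ring
  rw [← sum_proj lam V φ, ← sum_proj lam V ψ, ← sum_proj lam V χ]
  simp only [map_sum, LinearMap.sum_apply]
  exact Finset.sum_congr rfl fun m _ => Finset.sum_congr rfl fun l _ =>
    Finset.sum_congr rfl fun k _ => key k l m

theorem one_star (φ : OX Γ (piPre lam V)) : star b V 1 φ = φ := by
  conv_lhs => rw [← sum_proj lam V φ]
  conv_rhs => rw [← sum_proj lam V φ]
  rw [map_sum]
  refine Finset.sum_congr rfl fun k _ => ?_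
  rw [star_of_mem b V (one_mem_L lam V) (proj_mem lam V k φ), b.val_zero_left, one_smul, one_mul]

theorem star_one (φ : OX Γ (piPre lam V)) : star b V φ 1 = φ := by
  conv_lhs => rw [← sum_proj lam V φ]
  conv_rhs => rw [← sum_proj lam V φ]
  rw [map_sum, LinearMap.sum_apply]
  refine Finset.sum_congr rfl fun k _ => ?_
  rw [star_of_mem b V (proj_mem lam V k φ) (one_mem_L lam V), b.val_zero_right, one_smul, mul_one]

end

/-- The sections over `V` of the sheaf of algebras `𝒪_{X_λ} = (π_* 𝒪_X, ⋆_λ)` on `Y`. -/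
def StarSections {lam : UnitaryParameter g} [lam.IsTorsion] (_b : BilinearRep lam)
    (V : Opens (Y Γ lam)) : Type := OX Γ (piPre lam V)

section
variable {Γ}
variable {lam : UnitaryParameter g} [lam.IsTorsion] (b : BilinearRep lam)

instance (V : Opens (Y Γ lam)) : AddCommGroup (StarSections Γ b V) :=
  inferInstanceAs (AddCommGroup (OX Γ (piPre lam V)))

instance (V : Opens (Y Γ lam)) : Module ℂ (StarSections Γ b V) :=
  inferInstanceAs (Module ℂ (OX Γ (piPre lam V)))

instance (V : Opens (Y Γ lam)) : Ring (StarSections Γ b V) :=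
  { (inferInstance : AddCommGroup (StarSections Γ b V)) with
    mul := fun φ ψ => star b V φ ψ
    one := (1 : OX Γ (piPre lam V))
    mul_assoc := star_assoc b V
    one_mul := one_star b V
    mul_one := star_one b V
    left_distrib := fun φ ψ χ => map_add (star b V φ) ψ χ
    right_distrib := fun φ ψ χ => by
      change star b V _ _ = star b V _ _ + star b V _ _
      exact LinearMap.map_add₂ (star b V) φ ψ χ
    zero_mul := fun φ => LinearMap.map_zero₂ (star b V) φ
    mul_zero := fun φ => map_zero (star b V φ) }

instance (V : Opens (Y Γ lam)) : Algebra ℂ (StarSections Γ b V) :=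
  Algebra.ofModule (fun c φ ψ => LinearMap.map_smul₂ (star b V) c φ ψ)
    (fun c φ ψ => map_smul (star b V φ) c ψ)

/-- Restriction of holomorphic functions. -/
def OX.res {W W' : Opens (X Γ)} (h : W' ≤ W) : OX Γ W →ₐ[ℂ] OX Γ W' where
  toFun f := ⟨fun x => f.1 ⟨x, h x.2⟩,
    IsHolomorphic.mono (S := toX Γ ⁻¹' W) (S' := toX Γ ⁻¹' W') (fun _ hx => h hx) f.2⟩
  map_one' := rfl
  map_mul' _ _ := rfl
  map_zero' := rfl
  map_add' _ _ := rfl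
  commutes' _ := rfl

theorem proj_res {V V' : Opens (Y Γ lam)} (h : V' ≤ V) (k : lam.Khat) (φ : OX Γ (piPre lam V)) :
    proj lam V' k (OX.res (piPre_mono lam h) φ) = OX.res (piPre_mono lam h) (proj lam V k φ) := by
  rw [proj_apply, proj_apply, map_smul, map_sum]
  simp only [map_smul]
  rfl

theorem res_star {V V' : Opens (Y Γ lam)} (h : V' ≤ V) (φ ψ : OX Γ (piPre lam V)) :
    OX.res (piPre_mono lam h) (star b V φ ψ) =
      star b V' (OX.res (piPre_mono lam h) φ) (OX.res (piPre_mono lam h) ψ) := by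
  rw [star_apply, star_apply, map_sum]
  refine Finset.sum_congr rfl fun k _ => ?_
  rw [map_sum]
  refine Finset.sum_congr rfl fun l _ => ?_
  rw [map_smul, map_mul, proj_res h, proj_res h]

/-- Restriction for the sheaf of algebras `𝒪_{X_λ}`. -/
def StarSections.res {V V' : Opens (Y Γ lam)} (h : V' ≤ V) :
    StarSections Γ b V →ₐ[ℂ] StarSections Γ b V' :=
  AlgHom.ofLinearMap (OX.res (piPre_mono lam h)).toLinearMap rfl (fun φ ψ => res_star b h φ ψ)

variable (Γ)

/-- The presheaf underlying `𝒪_{X_λ}`. -/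
def starPresheaf : TopCat.Presheaf (AlgCat.{0} ℂ) (TopCat.of (Y Γ lam)) where
  obj V := AlgCat.of ℂ (StarSections Γ b V.unop)
  map i := AlgCat.ofHom (StarSections.res b i.unop.le)

/-- Gluing of functions. -/
theorem exists_glue {Z E ι : Type} {S : ι → Set Z} {S₀ : Set Z} (hS : ∀ x ∈ S₀, ∃ i, x ∈ S i)
    (f : ∀ i, S i → E)
    (hf : ∀ i j x (hi : x ∈ S i) (hj : x ∈ S j), f i ⟨x, hi⟩ = f j ⟨x, hj⟩) :
    ∃ F : S₀ → E, ∀ i x (hi : x ∈ S i) (h₀ : x ∈ S₀), F ⟨x, h₀⟩ = f i ⟨x, hi⟩ := by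
  choose i hi using hS
  exact ⟨fun x => f (i x x.2) ⟨x, hi x x.2⟩, fun j x hj h₀ => hf _ _ _ _ _⟩

theorem starPresheaf_isSheaf : (starPresheaf Γ b).IsSheaf := by
  rw [TopCat.Presheaf.isSheaf_iff_isSheafUniqueGluing]
  intro ι V sf hsf
  have hV : ∀ x ∈ piPre lam (iSup V), ∃ i, x ∈ piPre lam (V i) := by
    intro x hx
    have h : piXY Γ lam x ∈ iSup V := hx
    obtain ⟨i, hi⟩ := Opens.mem_iSup.1 h
    exact ⟨i, hi⟩
  let sf' : ∀ i, OX Γ (piPre lam (V i)) := sf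
  obtain ⟨F, hF⟩ := exists_glue (S := fun i => (piPre lam (V i) : Set (X Γ)))
    (S₀ := piPre lam (iSup V)) hV (fun i => (sf' i).1) (fun i j x hi hj =>
      congrFun (congrArg Subtype.val (hsf i j)) ⟨x, ⟨hi, hj⟩⟩)
  have hFhol : F ∈ OX Γ (piPre lam (iSup V)) := by
    refine isHolomorphic_of_local (S := toX Γ ⁻¹' (piPre lam (iSup V))) _ fun x hx => ?_
    obtain ⟨i, hi⟩ := hV _ hx
    refine ⟨toX Γ ⁻¹' (piPre lam (V i)), (piPre lam (V i)).2.preimage (continuous_toX Γ), hi,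
      fun y hy => piPre_mono lam (le_iSup V i) hy, ?_⟩
    obtain ⟨G, hG, hG'⟩ := (sf' i).2
    exact ⟨G, hG, fun y => (hF i _ y.2 _).trans (hG' y)⟩
  refine ⟨(⟨F, hFhol⟩ : OX Γ (piPre lam (iSup V))), ?_, ?_⟩
  · intro i
    apply Subtype.ext
    funext x
    exact hF i x x.2 _
  · intro G hG
    apply Subtype.ext
    funext x
    obtain ⟨i, hi⟩ := hV x x.2
    refine Eq.trans ?_ (hF i x hi x.2).symm
    exact congrFun (congrArg Subtype.val (hG i)) ⟨x, hi⟩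

/-- The sheaf of algebras `𝒪_{X_λ} = (π_* 𝒪_X, ⋆_λ)` on `Y`. -/
def starSheaf : TopCat.Sheaf (AlgCat.{0} ℂ) (TopCat.of (Y Γ lam)) :=
  ⟨starPresheaf Γ b, starPresheaf_isSheaf Γ b⟩

end

/-! ### Laurent series and their star product -/

section laurent

/-- The star product of two Laurent series given by their families of coefficients. -/
def laurentStar (lam : UnitaryParameter g) (a b : That g → ℂ) : That g → ℂ :=
  fun t => ∑' s : That g, (lam s (t - s) : ℂ) * a s * b (t - s)

/-- The Laurent series `∑ a_t t` converges absolutely on the torus `ϖ⁻¹(r)`. -/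
def LaurentSummable (r : AbsT g) (a : That g → ℂ) : Prop :=
  Summable fun t : That g => ‖a t‖ * absMonomial t r

variable {r : AbsT g} {a b c : That g → ℂ}

theorem LaurentSummable.prod (ha : LaurentSummable r a) (hb : LaurentSummable r b) :
    Summable fun p : That g × That g => ‖a p.2‖ * ‖b (p.1 - p.2)‖ * absMonomial p.1 r := by
  have h := Summable.mul_of_nonneg ha hb
    (fun t => mul_nonneg (norm_nonneg _) (absMonomial_pos t r).le)
    (fun t => mul_nonneg (norm_nonneg _) (absMonomial_pos t r).le)
  let e : That g × That g ≃ That g × That g :=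
    { toFun := fun p => (p.2, p.1 - p.2)
      invFun := fun q => (q.1 + q.2, q.1)
      left_inv := fun p => by ext <;> simp
      right_inv := fun q => by ext <;> simp }
  refine (e.summable_iff.2 h).congr fun p => ?_
  have : absMonomial p.1 r = absMonomial p.2 r * absMonomial (p.1 - p.2) r := by
    rw [← absMonomial_add, add_sub_cancel]
  simp only [Function.comp, e, Equiv.coe_fn_mk, this]
  ring

theorem LaurentSummable.fiber (ha : LaurentSummable r a) (hb : LaurentSummable r b) (t : That g) :
    Summable fun s : That g => ‖a s‖ * ‖b (t - s)‖ := by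
  have := (ha.prod hb).prod_factor t
  exact (summable_mul_right_iff (absMonomial_pos t r).ne').1 this

theorem norm_laurent_term (lam : UnitaryParameter g) (a b : That g → ℂ) (t s : That g) :
    ‖(lam s (t - s) : ℂ) * a s * b (t - s)‖ = ‖a s‖ * ‖b (t - s)‖ := by
  rw [norm_mul, norm_mul, Circle.norm_coe, one_mul]

theorem LaurentSummable.term (lam : UnitaryParameter g) (ha : LaurentSummable r a)
    (hb : LaurentSummable r b) (t : That g) :
    Summable fun s : That g => (lam s (t - s) : ℂ) * a s * b (t - s) :=
  Summable.of_norm ((ha.fiber hb t).congr fun s => (norm_laurent_term lam a b t s).symm)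

theorem LaurentSummable.conv (ha : LaurentSummable r a) (hb : LaurentSummable r b) :
    Summable fun t : That g => (∑' s : That g, ‖a s‖ * ‖b (t - s)‖) * absMonomial t r := by
  have h := (ha.prod hb).prod
  simp only [tsum_mul_right] at h
  exact h

theorem LaurentSummable.star (lam : UnitaryParameter g) (ha : LaurentSummable r a)
    (hb : LaurentSummable r b) : LaurentSummable r (laurentStar lam a b) := by
  refine Summable.of_nonneg_of_le
    (fun t => mul_nonneg (norm_nonneg _) (absMonomial_pos t r).le) (fun t => ?_) (ha.conv hb)
  refine mul_le_mul_of_nonneg_right ?_ (absMonomial_pos t r).le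
  have h := norm_tsum_le_tsum_norm (f := fun s => (lam s (t - s) : ℂ) * a s * b (t - s))
    ((ha.fiber hb t).congr fun s => (norm_laurent_term lam a b t s).symm)
  simp only [norm_laurent_term] at h
  exact h

theorem laurentStar_assoc (lam : UnitaryParameter g) (ha : LaurentSummable r a)
    (hb : LaurentSummable r b) (hc : LaurentSummable r c) :
    laurentStar lam (laurentStar lam a b) c = laurentStar lam a (laurentStar lam b c) := by
  funext t
  let F : That g → That g → ℂ := fun u s =>
    (lam u (t - u) : ℂ) * (lam s (u - s) : ℂ) * a s * b (u - s) * c (t - u)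
  have hF : Summable fun p : That g × That g => F p.1 p.2 := by
    refine Summable.of_norm ?_
    have e : ∀ p : That g × That g, ‖F p.1 p.2‖ = ‖a p.2‖ * ‖b (p.1 - p.2)‖ * ‖c (t - p.1)‖ := by
      intro p; simp only [F, norm_mul, Circle.norm_coe, one_mul]
    simp only [e]
    have h0 : 0 ≤ fun p : That g × That g => ‖a p.2‖ * ‖b (p.1 - p.2)‖ * ‖c (t - p.1)‖ :=
      fun p => mul_nonneg (mul_nonneg (norm_nonneg _) (norm_nonneg _)) (norm_nonneg _)
    refine (summable_prod_of_nonneg h0).2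
      ⟨fun u => Summable.mul_right ‖c (t - u)‖ (ha.fiber hb u), ?_⟩
    have hpos : ∀ u : That g, 0 ≤ ∑' s : That g, ‖a s‖ * ‖b (u - s)‖ :=
      fun u => tsum_nonneg fun s => mul_nonneg (norm_nonneg _) (norm_nonneg _)
    have hnorm : ∀ u : That g, ‖((∑' s : That g, ‖a s‖ * ‖b (u - s)‖ : ℝ) : ℂ)‖ =
        ∑' s : That g, ‖a s‖ * ‖b (u - s)‖ := fun u => by
      rw [Complex.norm_real, Real.norm_of_nonneg (hpos u)]
    have hn : LaurentSummable r fun u => ((∑' s : That g, ‖a s‖ * ‖b (u - s)‖ : ℝ) : ℂ) := by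
      unfold LaurentSummable
      simp only [hnorm]
      exact ha.conv hb
    have h := hn.fiber hc t
    simp only [hnorm] at h
    simp only [tsum_mul_right]
    exact h
  have h1 : laurentStar lam (laurentStar lam a b) c t = ∑' u, ∑' s, F u s := by
    refine tsum_congr fun u => ?_
    simp only [laurentStar]
    rw [← tsum_mul_left, ← tsum_mul_right]
    refine tsum_congr fun s => ?_
    simp only [F]; ring
  have h2 : laurentStar lam a (laurentStar lam b c) t = ∑' s, ∑' u, F u s := by
    refine tsum_congr fun s => ?_
    simp only [laurentStar]
    rw [← tsum_mul_left, ← (Equiv.subRight s).tsum_eq]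
    refine tsum_congr fun u => ?_
    have hco := lam.cocycle' s (u - s) (t - u)
    have e1 : u - s + (t - u) = t - s := by abel
    have e2 : s + (u - s) = u := by abel
    have e3 : t - s - (u - s) = t - u := by abel
    rw [e1, e2] at hco
    have hco' := congrArg (fun z : Circle => (z : ℂ)) hco
    simp only [Circle.coe_mul] at hco'
    simp only [F, Equiv.subRight_apply, e3]
    calc _ = ((lam (u - s) (t - u) : ℂ) * (lam s (t - s) : ℂ)) * (a s * b (u - s) * c (t - u)) := by
            ring
      _ = _ := by rw [hco']; ring
  rw [h1, h2]
  exact (Summable.tsum_comm (f := F) hF).symm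

/-- The unit for the star product of Laurent series. -/
def laurentOne (lam : UnitaryParameter g) : That g → ℂ := Pi.single 0 ((lam 0 0 : ℂ)⁻¹)

theorem laurentOne_summable (lam : UnitaryParameter g) (r : AbsT g) :
    LaurentSummable r (laurentOne lam) := by
  refine summable_of_ne_finset_zero (s := {0}) fun t ht => ?_
  have : t ≠ 0 := by simpa using ht
  simp [laurentOne, this]

theorem laurentOne_star (lam : UnitaryParameter g) (a : That g → ℂ) :
    laurentStar lam (laurentOne lam) a = a := by
  funext t
  simp only [laurentStar]
  rw [tsum_eq_single 0]
  · simp [laurentOne, lam.zero_left]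
  · intro s hs; simp [laurentOne, hs]

theorem laurentStar_one (lam : UnitaryParameter g) (a : That g → ℂ) :
    laurentStar lam a (laurentOne lam) = a := by
  funext t
  simp only [laurentStar]
  rw [tsum_eq_single t]
  · simp only [sub_self, laurentOne, Pi.single_eq_same, lam.zero_right]
    field_simp [Circle.coe_ne_zero]
  · intro s hs
    have : t - s ≠ 0 := sub_ne_zero.2 (Ne.symm hs)
    simp [laurentOne, this]

theorem laurentStar_add_left (lam : UnitaryParameter g) {a' : That g → ℂ}
    (ha : LaurentSummable r a) (ha' : LaurentSummable r a') (hb : LaurentSummable r b) :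
    laurentStar lam (a + a') b = laurentStar lam a b + laurentStar lam a' b := by
  funext t
  simp only [laurentStar, Pi.add_apply]
  rw [← (ha.term lam hb t).tsum_add (ha'.term lam hb t)]
  exact tsum_congr fun s => by ring

theorem laurentStar_add_right (lam : UnitaryParameter g) {b' : That g → ℂ}
    (ha : LaurentSummable r a) (hb : LaurentSummable r b) (hb' : LaurentSummable r b') :
    laurentStar lam a (b + b') = laurentStar lam a b + laurentStar lam a b' := by
  funext t
  simp only [laurentStar, Pi.add_apply]
  rw [← (ha.term lam hb t).tsum_add (ha.term lam hb' t)]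
  exact tsum_congr fun s => by ring

theorem laurentStar_smul_left (lam : UnitaryParameter g) (z : ℂ) (a b : That g → ℂ) :
    laurentStar lam (z • a) b = z • laurentStar lam a b := by
  funext t
  simp only [laurentStar, Pi.smul_apply, smul_eq_mul]
  rw [← tsum_mul_left]
  exact tsum_congr fun s => by ring

theorem laurentStar_smul_right (lam : UnitaryParameter g) (z : ℂ) (a b : That g → ℂ) :
    laurentStar lam a (z • b) = z • laurentStar lam a b := by
  funext t
  simp only [laurentStar, Pi.smul_apply, smul_eq_mul]
  rw [← tsum_mul_left]
  exact tsum_congr fun s => by ring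

/-- Convergent Laurent series on an open subset `U` of `|T|`. A holomorphic function on `ϖ⁻¹(U)`
has a Laurent expansion on the preimage of each box contained in `U`, converging absolutely there;
the coefficients are therefore locally constant on `U`, but may differ from one connected
component to another. -/
def laurent (U : Opens (AbsT g)) : Submodule ℂ (U → That g → ℂ) where
  carrier := {a | IsLocallyConstant a ∧ ∀ r : U, LaurentSummable (r : AbsT g) (a r)}
  zero_mem' := ⟨IsLocallyConstant.const 0, fun r => by
    simp [LaurentSummable]⟩
  add_mem' := by
    rintro a b ⟨ha, ha'⟩ ⟨hb, hb'⟩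
    refine ⟨ha.add hb, fun r => ?_⟩
    refine Summable.of_nonneg_of_le
      (fun t => mul_nonneg (norm_nonneg _) (absMonomial_pos t r).le) (fun t => ?_)
      ((ha' r).add (hb' r))
    rw [← add_mul]
    exact mul_le_mul_of_nonneg_right (norm_add_le _ _) (absMonomial_pos t r).le
  smul_mem' := by
    rintro z a ⟨ha, ha'⟩
    refine ⟨ha.comp (z • ·), fun r => ?_⟩
    refine ((ha' r).mul_left ‖z‖).congr fun t => ?_
    simp [mul_assoc]

/-- The sections over `U` of the sheaf of algebras `𝒪_{𝖳_λ}` on `|T|`. -/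
def LaurentSections (_lam : UnitaryParameter g) (U : Opens (AbsT g)) : Type := laurent U

variable (lam : UnitaryParameter g)

instance (U : Opens (AbsT g)) : AddCommGroup (LaurentSections lam U) :=
  inferInstanceAs (AddCommGroup (laurent U))

instance (U : Opens (AbsT g)) : Module ℂ (LaurentSections lam U) :=
  inferInstanceAs (Module ℂ (laurent U))

/-- The star product of sections of `𝒪_{𝖳_λ}`. -/
def LaurentSections.mul {U : Opens (AbsT g)} (a b : LaurentSections lam U) :
    LaurentSections lam U :=
  ⟨fun r => laurentStar lam (a.1 r) (b.1 r),
    a.2.1.comp₂ b.2.1 (laurentStar lam), fun r => (a.2.2 r).star lam (b.2.2 r)⟩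

/-- The unit section of `𝒪_{𝖳_λ}`. -/
def LaurentSections.one (U : Opens (AbsT g)) : LaurentSections lam U :=
  ⟨fun _ => laurentOne lam, IsLocallyConstant.const _, fun r => laurentOne_summable lam r⟩

instance (U : Opens (AbsT g)) : Ring (LaurentSections lam U) :=
  { (inferInstance : AddCommGroup (LaurentSections lam U)) with
    mul := LaurentSections.mul lam
    one := LaurentSections.one lam U
    mul_assoc := fun a b c => Subtype.ext <| funext fun r =>
      laurentStar_assoc lam (a.2.2 r) (b.2.2 r) (c.2.2 r)
    one_mul := fun a => Subtype.ext <| funext fun _ => laurentOne_star lam _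
    mul_one := fun a => Subtype.ext <| funext fun _ => laurentStar_one lam _
    left_distrib := fun a b c => Subtype.ext <| funext fun r =>
      laurentStar_add_right lam (a.2.2 r) (b.2.2 r) (c.2.2 r)
    right_distrib := fun a b c => Subtype.ext <| funext fun r =>
      laurentStar_add_left lam (a.2.2 r) (b.2.2 r) (c.2.2 r)
    zero_mul := fun a => Subtype.ext <| funext fun r => by
      change laurentStar lam 0 _ = 0
      funext t; simp [laurentStar]
    mul_zero := fun a => Subtype.ext <| funext fun r => by
      change laurentStar lam _ 0 = 0
      funext t; simp [laurentStar] }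

instance (U : Opens (AbsT g)) : Algebra ℂ (LaurentSections lam U) :=
  Algebra.ofModule
    (fun z a b => Subtype.ext <| funext fun r => laurentStar_smul_left lam z (a.1 r) (b.1 r))
    (fun z a b => Subtype.ext <| funext fun r => laurentStar_smul_right lam z (a.1 r) (b.1 r))

/-- Restriction for the sheaf of algebras `𝒪_{𝖳_λ}`. -/
def LaurentSections.res {U U' : Opens (AbsT g)} (h : U' ≤ U) :
    LaurentSections lam U →ₐ[ℂ] LaurentSections lam U' :=
  AlgHom.ofLinearMap
    { toFun := fun a => ⟨fun r => a.1 ⟨r, h r.2⟩,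
        a.2.1.comp_continuous (continuous_inclusion h), fun r => a.2.2 ⟨r, h r.2⟩⟩
      map_add' := fun _ _ => rfl
      map_smul' := fun _ _ => rfl }
    rfl (fun _ _ => rfl)

/-- The preimage in `|T|` of an open subset of `|X|`. -/
def absPre (U : Opens (AbsX Γ)) : Opens (AbsT g) :=
  ⟨toAbsX Γ ⁻¹' U, U.2.preimage (continuous_toAbsX Γ)⟩

/-- The sections over `U` of the sheaf of algebras `𝒪_{𝖷_λ}` of `𝖷_λ = 𝖳_λ / Γ`: the sections of
`𝒪_{𝖳_λ}` over the preimage of `U` that are invariant under the action of `Γ`, where `γ` sends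
`∑ a_t t` to `∑ a_t t(γ)⁻¹ t` over the translated open set. -/
def ncSections (U : Opens (AbsX Γ)) : Subalgebra ℂ (LaurentSections lam (absPre Γ U)) where
  carrier := {a | ∀ γ ∈ Γ, ∀ (r : AbsT g) (hr : r ∈ absPre Γ U)
    (hr' : r * (varpi g γ)⁻¹ ∈ absPre Γ U) (t : That g),
    a.1 ⟨r, hr⟩ t = a.1 ⟨r * (varpi g γ)⁻¹, hr'⟩ t * ((monomial t γ)⁻¹ : ℂˣ)}
  mul_mem' := by
    intro a b ha hb γ hγ r hr hr' t
    change laurentStar lam _ _ t = laurentStar lam _ _ t * _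
    simp only [laurentStar]
    rw [← tsum_mul_right]
    refine tsum_congr fun s => ?_
    have : monomial t γ = monomial s γ * monomial (t - s) γ := by
      rw [← MonoidHom.mul_apply, ← monomial_add, add_sub_cancel]
    rw [ha γ hγ r hr hr' s, hb γ hγ r hr hr' (t - s), this, mul_inv, Units.val_mul]
    ring
  add_mem' := by
    intro a b ha hb γ hγ r hr hr' t
    exact (congrArg₂ (· + ·) (ha γ hγ r hr hr' t) (hb γ hγ r hr hr' t)).trans (add_mul _ _ _).symm
  algebraMap_mem' z := by
    intro γ hγ r hr hr' t
    change z * laurentOne lam t = z * laurentOne lam t * _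
    by_cases ht : t = 0
    · subst ht; simp [monomial_zero]
    · simp [laurentOne, ht]

/-- The presheaf underlying `𝒪_{𝖷_λ}`. -/
def ncPresheaf : TopCat.Presheaf (AlgCat.{0} ℂ) (TopCat.of (AbsX Γ)) where
  obj U := AlgCat.of ℂ (ncSections Γ lam U.unop)
  map {U U'} i := AlgCat.ofHom
    (((LaurentSections.res lam
        (show absPre Γ U'.unop ≤ absPre Γ U.unop from fun _ hx => i.unop.le hx)).comp
      (ncSections Γ lam U.unop).val).codRestrict (ncSections Γ lam U'.unop)
      fun a γ hγ r _ _ t => a.2 γ hγ r _ _ t)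

theorem ncPresheaf_isSheaf : (ncPresheaf Γ lam).IsSheaf := by
  rw [TopCat.Presheaf.isSheaf_iff_isSheafUniqueGluing]
  intro ι U sf hsf
  have hU : ∀ r ∈ absPre Γ (iSup U), ∃ i, r ∈ absPre Γ (U i) := by
    intro r hr
    have h : toAbsX Γ r ∈ iSup U := hr
    obtain ⟨i, hi⟩ := Opens.mem_iSup.1 h
    exact ⟨i, hi⟩
  let sf' : ∀ i, ncSections Γ lam (U i) := sf
  obtain ⟨F, hF⟩ := exists_glue (S := fun i => (absPre Γ (U i) : Set (AbsT g)))
    (S₀ := absPre Γ (iSup U)) hU (fun i => (sf' i).1.1) (fun i j x hi hj =>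
      congrFun (congrArg (fun s => s.1.1) (hsf i j)) ⟨x, ⟨hi, hj⟩⟩)
  have hF1 : F ∈ laurent (absPre Γ (iSup U)) := by
    constructor
    · rw [IsLocallyConstant.iff_eventually_eq]
      intro r
      obtain ⟨i, hi⟩ := hU r r.2
      have h1 := (IsLocallyConstant.iff_eventually_eq _).1 (sf' i).1.2.1 ⟨r, hi⟩
      have h2 := (absPre Γ (U i)).2.isOpenEmbedding_subtypeVal.map_nhds_eq ⟨r, hi⟩
      have h3 : ∀ᶠ y in nhds (r : AbsT g), ∀ (hy : y ∈ absPre Γ (U i)),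
          (sf' i).1.1 ⟨y, hy⟩ = (sf' i).1.1 ⟨r, hi⟩ := by
        rw [← h2, Filter.eventually_map]
        filter_upwards [h1] with y hy _ using hy
      have h4 : ∀ᶠ y in nhds (r : AbsT g), y ∈ absPre Γ (U i) :=
        (absPre Γ (U i)).2.mem_nhds hi
      filter_upwards [continuous_subtype_val.continuousAt.eventually h3,
        continuous_subtype_val.continuousAt.eventually h4] with y hy hy'
      exact (hF i y hy' y.2).trans ((hy hy').trans (hF i r hi r.2).symm)
    · intro r
      obtain ⟨i, hi⟩ := hU r r.2
      have := (sf' i).1.2.2 ⟨r, hi⟩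
      rw [← hF i r hi r.2] at this
      exact this
  have hF2 : (⟨F, hF1⟩ : LaurentSections lam (absPre Γ (iSup U))) ∈ ncSections Γ lam (iSup U) := by
    intro γ hγ r hr hr' t
    obtain ⟨i, hi⟩ := hU r hr
    have hi' : r * (varpi g γ)⁻¹ ∈ absPre Γ (U i) := by
      have h1 : toAbsX Γ (varpi g γ) = 1 := (QuotientGroup.eq_one_iff _).2 ⟨γ, hγ, rfl⟩
      have h2 : toAbsX Γ (r * (varpi g γ)⁻¹) = toAbsX Γ r := by
        rw [map_mul, map_inv, h1, inv_one, mul_one]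
      change toAbsX Γ _ ∈ U i
      rw [h2]
      exact hi
    have := (sf' i).2 γ hγ r hi hi' t
    rw [← hF i r hi hr, ← hF i _ hi' hr'] at this
    exact this
  refine ⟨(⟨⟨F, hF1⟩, hF2⟩ : ncSections Γ lam (iSup U)), ?_, ?_⟩
  · intro i
    apply Subtype.ext
    apply Subtype.ext
    funext x
    exact hF i x x.2 _
  · intro G hG
    apply Subtype.ext
    apply Subtype.ext
    funext x
    obtain ⟨i, hi⟩ := hU x x.2
    refine Eq.trans ?_ (hF i x hi x.2).symm
    exact congrFun (congrArg (fun s => s.1.1) (hG i)) ⟨x, hi⟩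

/-- The sheaf of algebras `𝒪_{𝖷_λ}` of the non-commutative complex torus `𝖷_λ = 𝖳_λ / Γ`. -/
def ncSheaf : TopCat.Sheaf (AlgCat.{0} ℂ) (TopCat.of (AbsX Γ)) :=
  ⟨ncPresheaf Γ lam, ncPresheaf_isSheaf Γ lam⟩

end laurent

/-- The continuous map `ϖ_Y : Y → |X|`. -/
def varpiYHom (lam : UnitaryParameter g) [lam.IsTorsion] :
    TopCat.of (Y Γ lam) ⟶ TopCat.of (AbsX Γ) :=
  TopCat.ofHom ⟨varpiY Γ lam, continuous_varpiY Γ lam⟩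

end NCTorus

end

/-!
Sections of the Laurent-series sheaf are identified with holomorphic functions by summing the
series. Write `λ` as the product of the bilinear cocycle `b` and the coboundary of a cochain `α`.
An invariant section `a` over an open `U ⊆ |X|` is sent to the function
`x ↦ ∑ t, α t * a_{|x|} t * t(x)`, which is `Γ`-invariant and so lives on the preimage of `U` in
`X` (`evalX`). Three facts make this an isomorphism of sheaves of algebras.

* It is multiplicative. Averaging over `K` against the character `k` keeps exactly the monomials
  whose exponent represents `k` (`proj_apply_eq_tsum`), so the star product of functions multiplies
  the monomials `s` and `t` with the factor `b (s, t)` (`star_apply_eq_tsum`); the factor `α` turns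
  `λ` into `b` (`laurentEval_twist_star`).
* It is well defined and injective. The sum of a convergent Laurent series is holomorphic
  (`isHolomorphic_laurentEval`): on a box in `|T|` each monomial is dominated by the sum of its
  values at the corners, and the M-test for holomorphic functions of several variables applies.
  The coefficients are recovered as Fourier coefficients on a single torus `ϖ⁻¹(r)`
  (`laurentEval_injective`).
* It is surjective. The Laurent coefficients of a holomorphic function `G` on `ϖ⁻¹(D)` are the
  torus averages of `G(z) z ^ (-t)`. Such an average is holomorphic in `z` and invariant under
  rotations; the derivative in the direction `i z_j e_j` vanishes, hence by `ℂ`-linearity so does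
  the whole derivative (`fderiv_torusAverage`), and the coefficients are locally constant on `D`.
  The Cauchy estimates at the corners of a box then give absolute convergence at its centre
  (`laurentSummable_laurentCoeff`), and the Fourier series of `G` on each torus sums to `G`
  (`eq_laurentEval_laurentCoeff`). The `Γ`-invariance of the coefficients follows from uniqueness.
-/

noncomputable section

namespace NCTorus

variable {g : ℕ}

/-! ### Holomorphic functions on complex normed spaces -/

section cauchy

variable {E : Type*} [NormedAddCommGroup E] [NormedSpace ℂ E]

/-- A Cauchy estimate for the Fréchet derivative, read off from the Schwarz lemma. -/
theorem norm_fderiv_le_of_norm_le {f : E → ℂ} {c : E} {R M : ℝ} (hR : 0 < R)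
    (hf : DifferentiableOn ℂ f (Metric.ball c R)) (hM : ∀ z ∈ Metric.ball c R, ‖f z‖ ≤ M) :
    ‖fderiv ℂ f c‖ ≤ 2 * M / R := by
  refine Complex.norm_fderiv_le_div_of_mapsTo_ball hf (fun z hz => ?_) hR
  rw [mem_closedBall_iff_norm]
  have h := norm_sub_le (f z) (f c)
  have h1 := hM z hz
  have h2 := hM c (Metric.mem_ball_self hR)
  linarith

/-- The Weierstrass M-test for holomorphic functions on an open subset of a complex normed space:
the Cauchy estimate turns a summable bound on the terms into one on their derivatives. -/
theorem differentiableOn_tsum_of_norm_le {ι : Type*} {u : ι → ℝ} (hu : Summable u)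
    {f : ι → E → ℂ} {U : Set E} (hU : IsOpen U) (hf : ∀ i, DifferentiableOn ℂ (f i) U)
    (hb : ∀ i, ∀ z ∈ U, ‖f i z‖ ≤ u i) : DifferentiableOn ℂ (fun z => ∑' i, f i z) U := by
  intro z hz
  obtain ⟨ε, hε, hball⟩ := Metric.isOpen_iff.1 hU z hz
  -- balls of radius `ε / 2` around points of the ball of radius `ε / 2` leave room for the estimate
  have hsub : ∀ w ∈ Metric.ball z (ε / 2), Metric.ball w (ε / 2) ⊆ U := fun w hw =>
    (Metric.ball_subset_ball' (by rw [Metric.mem_ball] at hw; linarith)).trans hball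
  have hz' : z ∈ Metric.ball z (ε / 2) := Metric.mem_ball_self (half_pos hε)
  have : NormedSpace ℝ E := NormedSpace.restrictScalars ℝ ℂ E
  refine (hasFDerivAt_tsum_of_isPreconnected (u := fun i => 2 * u i / (ε / 2))
    (f' := fun i w => fderiv ℂ (f i) w) ((hu.mul_left 2).div_const _) Metric.isOpen_ball
    (convex_ball z (ε / 2)).isPreconnected (fun i w hw => ?_) (fun i w hw => ?_) hz' ?_
    hz').differentiableAt.differentiableWithinAt
  · exact ((hf i).differentiableAt (hU.mem_nhds
      (hsub w hw (Metric.mem_ball_self (half_pos hε))))).hasFDerivAt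
  · exact norm_fderiv_le_of_norm_le (half_pos hε) ((hf i).mono (hsub w hw))
      fun y hy => hb i y (hsub w hw hy)
  · exact Summable.of_norm_bounded hu fun i => hb i z hz

end cauchy

/-! ### Averages over the unit torus -/

section torus

open MeasureTheory

/-- The point `(exp (2πi θ_j))_j` of the unit torus in `ℂ^g`. -/
def unitPt (θ : UnitAddTorus (Fin g)) : Fin g → ℂ := fun i => fourier 1 (θ i)

/-- The normalized Haar measure of the unit torus. -/
def haarTorus (g : ℕ) : Measure (UnitAddTorus (Fin g)) :=
  Measure.pi fun _ => AddCircle.haarAddCircle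

instance : IsProbabilityMeasure (haarTorus g) := by unfold haarTorus; infer_instance

instance : (haarTorus g).IsAddLeftInvariant := by unfold haarTorus; infer_instance

theorem norm_unitPt (θ : UnitAddTorus (Fin g)) (i : Fin g) : ‖unitPt θ i‖ = 1 := by
  rw [unitPt, fourier_one]; exact Circle.norm_coe _

theorem unitPt_ne_zero (θ : UnitAddTorus (Fin g)) (i : Fin g) : unitPt θ i ≠ 0 := by
  rw [← norm_pos_iff, norm_unitPt]; exact one_pos

theorem unitPt_zero : unitPt (0 : UnitAddTorus (Fin g)) = 1 := by
  funext i; simp [unitPt]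

theorem unitPt_add (θ φ : UnitAddTorus (Fin g)) : unitPt (θ + φ) = unitPt θ * unitPt φ := by
  funext i; simp [unitPt, AddCircle.toCircle_add]

theorem continuous_unitPt : Continuous (unitPt (g := g)) := by
  unfold unitPt; fun_prop

theorem norm_mul_unitPt (z : Fin g → ℂ) (θ : UnitAddTorus (Fin g)) : ‖z * unitPt θ‖ = ‖z‖ := by
  simp only [Pi.norm_def, Pi.mul_apply, nnnorm_mul]
  have : ∀ i, ‖unitPt θ i‖₊ = 1 := fun i => NNReal.eq (norm_unitPt θ i)
  simp [this]

theorem exists_unitPt_eq {u : Fin g → ℂ} (hu : ∀ i, ‖u i‖ = 1) : ∃ θ, unitPt θ = u := by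
  have h : ∀ i, ∃ θ : UnitAddCircle, fourier 1 θ = u i := fun i => by
    obtain ⟨θ, hθ⟩ := (AddCircle.homeomorphCircle one_ne_zero).surjective
      (⟨u i, mem_sphere_zero_iff_norm.2 (hu i)⟩ : Circle)
    refine ⟨θ, ?_⟩
    rw [fourier_one, ← AddCircle.homeomorphCircle_apply one_ne_zero, hθ]
  choose θ hθ using h
  exact ⟨θ, funext hθ⟩

/-- The average of a function over the orbit of `z` under the unit torus. -/
def torusAverage (h : (Fin g → ℂ) → ℂ) (z : Fin g → ℂ) : ℂ :=
  ∫ θ, h (z * unitPt θ) ∂haarTorus g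

theorem torusAverage_mul_unitPt (h : (Fin g → ℂ) → ℂ) (z : Fin g → ℂ)
    (φ : UnitAddTorus (Fin g)) : torusAverage h (z * unitPt φ) = torusAverage h z := by
  unfold torusAverage
  simp only [mul_assoc, ← unitPt_add]
  exact integral_add_left_eq_self (μ := haarTorus g) (fun θ => h (z * unitPt θ)) φ

/-- A torus-invariant subset of `(ℂˣ)^g ⊆ ℂ^g`. -/
structure IsReinhardt (S : Set (Fin g → ℂ)) : Prop where
  ne_zero : ∀ z ∈ S, ∀ i, z i ≠ 0
  mul_mem : ∀ z ∈ S, ∀ θ, z * unitPt θ ∈ S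

variable {S : Set (Fin g → ℂ)} {h : (Fin g → ℂ) → ℂ}

theorem continuous_orbit (hS : IsReinhardt S) (hc : ContinuousOn h S) {z : Fin g → ℂ}
    (hz : z ∈ S) : Continuous fun θ => h (z * unitPt θ) :=
  hc.comp_continuous (continuous_const.mul continuous_unitPt) fun θ => hS.mul_mem z hz θ

theorem integrable_of_continuous {f : UnitAddTorus (Fin g) → ℂ} (hf : Continuous f) :
    Integrable f (haarTorus g) :=
  hf.integrable_of_hasCompactSupport (HasCompactSupport.of_compactSpace f)

/-- The torus average of a holomorphic function is holomorphic. -/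
theorem differentiableAt_torusAverage (hS : IsReinhardt S) (hSo : IsOpen S)
    (hh : DifferentiableOn ℂ h S) {z : Fin g → ℂ} (hz : z ∈ S) :
    DifferentiableAt ℂ (torusAverage h) z := by
  -- `h` is bounded by `M` on the `δ`-thickening of the orbit of `z`, so that the integrand, as a
  -- function of `w` near `z`, has derivative at most `2 * M / (δ / 2)` uniformly in `θ`
  let Kz : Set (Fin g → ℂ) := Set.range fun θ => z * unitPt θ
  have hKc : IsCompact Kz := isCompact_range (continuous_const.mul continuous_unitPt)
  have hKS : Kz ⊆ S := by rintro _ ⟨θ, rfl⟩; exact hS.mul_mem z hz θ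
  obtain ⟨δ, hδ, hsub⟩ := hKc.exists_cthickening_subset_open hSo hKS
  obtain ⟨M, hM⟩ := hKc.cthickening.exists_bound_of_continuousOn (hh.continuousOn.mono hsub)
  have hδ2 := half_pos hδ
  have hmem : ∀ θ, ∀ w ∈ Metric.ball z (δ / 2), ∀ y ∈ Metric.ball w (δ / 2),
      y * unitPt θ ∈ Metric.cthickening δ Kz := fun θ w hw y hy => by
    refine Metric.mem_cthickening_of_dist_le _ (z * unitPt θ) _ _ ⟨θ, rfl⟩ ?_
    rw [dist_eq_norm, ← sub_mul, norm_mul_unitPt, ← dist_eq_norm]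
    have := dist_triangle y w z
    rw [Metric.mem_ball] at hw hy
    linarith
  have hself : ∀ w : Fin g → ℂ, w ∈ Metric.ball w (δ / 2) := fun w => Metric.mem_ball_self hδ2
  have hmul : ∀ θ : UnitAddTorus (Fin g), Differentiable ℂ fun w : Fin g → ℂ => w * unitPt θ :=
    fun θ => by fun_prop
  have hd : ∀ θ, ∀ w ∈ Metric.ball z (δ / 2),
      DifferentiableOn ℂ (fun y => h (y * unitPt θ)) (Metric.ball w (δ / 2)) := fun θ w hw =>
    hh.comp (hmul θ).differentiableOn fun y hy => hsub (hmem θ w hw y hy)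
  have hS' : ∀ w ∈ Metric.ball z (δ / 2), w ∈ S := fun w hw => by
    simpa [unitPt_zero] using hsub (hmem 0 w hw w (hself w))
  refine (hasFDerivAt_integral_of_dominated_of_fderiv_le (𝕜 := ℂ)
    (F' := fun w θ => fderiv ℂ (fun y => h (y * unitPt θ)) w)
    (bound := fun _ => 2 * M / (δ / 2)) (Metric.ball_mem_nhds z hδ2) ?_ ?_ ?_ ?_ ?_ ?_ :
    HasFDerivAt (fun w => ∫ θ, h (w * unitPt θ) ∂haarTorus g) _ z).differentiableAt
  · filter_upwards [Metric.ball_mem_nhds z hδ2] with w hw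
    exact (continuous_orbit hS hh.continuousOn (hS' w hw)).aestronglyMeasurable
  · exact integrable_of_continuous (continuous_orbit hS hh.continuousOn hz)
  -- measurability in `θ` of the derivative, written through `fderiv ℂ h`, which is measurable
  -- on the whole space
  · have e : ∀ θ, fderiv ℂ (fun y => h (y * unitPt θ)) z =
        (fderiv ℂ h (z * unitPt θ)).comp (ContinuousLinearMap.mul ℂ (Fin g → ℂ) (unitPt θ)) := by
      intro θ
      have h1 : HasFDerivAt (fun w : Fin g → ℂ => w * unitPt θ)
          (ContinuousLinearMap.mul ℂ (Fin g → ℂ) (unitPt θ)) z := by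
        simp only [mul_comm _ (unitPt θ)]
        exact (ContinuousLinearMap.mul ℂ (Fin g → ℂ) (unitPt θ)).hasFDerivAt
      exact ((hh.differentiableAt (hSo.mem_nhds (hS.mul_mem z hz θ))).hasFDerivAt.comp z
        h1).fderiv
    simp only [e]
    have m1 : StronglyMeasurable fun θ => fderiv ℂ h (z * unitPt θ) :=
      (measurable_fderiv ℂ h).stronglyMeasurable.comp_measurable
        (continuous_const.mul continuous_unitPt).measurable
    have m2 : StronglyMeasurable fun θ : UnitAddTorus (Fin g) =>
        ContinuousLinearMap.mul ℂ (Fin g → ℂ) (unitPt θ) :=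
      ((ContinuousLinearMap.mul ℂ (Fin g → ℂ)).continuous.comp
        continuous_unitPt).stronglyMeasurable
    exact (isBoundedBilinearMap_comp.continuous.comp_stronglyMeasurable
      (m1.prodMk m2)).aestronglyMeasurable
  · refine Filter.Eventually.of_forall fun θ w hw => ?_
    exact norm_fderiv_le_of_norm_le hδ2 (hd θ w hw) fun y hy => hM _ (hmem θ w hw y hy)
  · exact integrable_const _
  · refine Filter.Eventually.of_forall fun θ w hw => ?_
    exact ((hd θ w hw).differentiableAt (Metric.isOpen_ball.mem_nhds (hself w))).hasFDerivAt

/-- The torus average of a holomorphic function has vanishing derivative: by rotation invariance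
its derivative in the direction `i z_j e_j` vanishes, and the derivative is `ℂ`-linear. -/
theorem fderiv_torusAverage (hS : IsReinhardt S) (hSo : IsOpen S)
    (hh : DifferentiableOn ℂ h S) {z : Fin g → ℂ} (hz : z ∈ S) :
    fderiv ℂ (torusAverage h) z = 0 := by
  have hD := (differentiableAt_torusAverage hS hSo hh hz).hasFDerivAt
  have key : ∀ j : Fin g, fderiv ℂ (torusAverage h) z (Pi.single j 1) = 0 := by
    intro j
    -- the rotation of the `j`-th coordinate, with velocity `2πi z_j` at time `0`
    let γ : ℝ → (Fin g → ℂ) := fun s => z * unitPt (Pi.single j (s : UnitAddCircle))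
    have hγ0 : γ 0 = z := by
      simp [γ, unitPt_zero]
    let v : ℂ := 2 * Real.pi * Complex.I * z j
    have hγ : HasDerivAt γ (Pi.single j v) 0 := by
      rw [hasDerivAt_pi]
      intro i
      by_cases hij : i = j
      · subst hij
        have h1 := hasDerivAt_fourier 1 1 0
        have h2 := h1.const_mul (z i)
        simp only [γ, unitPt, Pi.mul_apply, Pi.single_eq_same]
        refine h2.congr_deriv ?_
        simp [v]; ring
      · have : (fun s => γ s i) = fun _ => z i := by
          funext s; simp [γ, unitPt, hij]
        rw [this, Pi.single_eq_of_ne hij]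
        exact hasDerivAt_const _ _
    have h1 : HasDerivAt (torusAverage h ∘ γ) (fderiv ℂ (torusAverage h) z (Pi.single j v)) 0 := by
      have hD' : HasFDerivAt (torusAverage h)
          ((fderiv ℂ (torusAverage h) z).restrictScalars ℝ) (γ 0) := by
        rw [hγ0]; exact hD.restrictScalars ℝ
      exact hD'.comp_hasDerivAt 0 hγ
    have h2 : torusAverage h ∘ γ = fun _ => torusAverage h z :=
      funext fun s => torusAverage_mul_unitPt h z _
    rw [h2] at h1
    have h3 := h1.unique (hasDerivAt_const (0 : ℝ) (torusAverage h z))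
    have hv : v ≠ 0 := by
      have := hS.ne_zero z hz j
      have := Real.pi_ne_zero
      simp [v, Complex.I_ne_zero, *]
    have h4 : (Pi.single j v : Fin g → ℂ) = v • Pi.single j 1 := by
      rw [← Pi.single_smul]; simp
    rw [h4, map_smul, smul_eq_mul] at h3
    exact (mul_eq_zero.1 h3).resolve_left hv
  refine ContinuousLinearMap.coe_injective (LinearMap.pi_ext' fun j => LinearMap.ext_ring ?_)
  simpa using key j

theorem torusAverage_eq_of_mem_ball (hS : IsReinhardt S) (hSo : IsOpen S)
    (hh : DifferentiableOn ℂ h S) {z w : Fin g → ℂ} {ε : ℝ} (hball : Metric.ball z ε ⊆ S)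
    (hw : w ∈ Metric.ball z ε) : torusAverage h w = torusAverage h z := by
  have hz : z ∈ Metric.ball z ε := Metric.mem_ball_self (dist_nonneg.trans_lt hw)
  refine (convex_ball z ε).is_const_of_fderivWithin_eq_zero (𝕜 := ℂ)
    (fun y hy => (differentiableAt_torusAverage hS hSo hh
      (hball hy)).differentiableWithinAt) (fun y hy => ?_) hw hz
  rw [fderivWithin_of_isOpen Metric.isOpen_ball hy, fderiv_torusAverage hS hSo hh (hball hy)]

end torus

/-! ### Monomials in polar coordinates -/

section expansion

open MeasureTheory UnitAddTorus

/-- The Laurent monomial `z ↦ ∏ i, z i ^ t i` as a function on `ℂ^g`. -/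
def cmon (t : That g) (z : Fin g → ℂ) : ℂ := ∏ i, z i ^ t i

theorem cmon_coord (t : That g) (x : T g) : cmon t (coord x) = (monomial t x : ℂ) := by
  simp [cmon, coord, monomial]

theorem cmon_mul (t : That g) (z w : Fin g → ℂ) : cmon t (z * w) = cmon t z * cmon t w := by
  simp [cmon, mul_zpow, Finset.prod_mul_distrib]

theorem cmon_neg (t : That g) (z : Fin g → ℂ) : cmon (-t) z = (cmon t z)⁻¹ := by
  simp [cmon]

theorem cmon_unitPt (t : That g) (θ : UnitAddTorus (Fin g)) :
    cmon t (unitPt θ) = mFourier t θ := by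
  simp only [cmon, unitPt, mFourier, ContinuousMap.coe_mk]
  refine Finset.prod_congr rfl fun i _ => ?_
  rw [fourier_one, fourier_apply, AddCircle.toCircle_zsmul, Circle.coe_zpow]

theorem norm_monomial (t : That g) (x : T g) :
    ‖(monomial t x : ℂ)‖ = absMonomial t (varpi g x) := by
  simp [monomial, absMonomial, varpi]

/-- The point of `|T|`, seen in `ℂ^g`. -/
def absPt (r : AbsT g) : Fin g → ℂ := fun i => ((r i : ℝ) : ℂ)

theorem cmon_absPt (t : That g) (r : AbsT g) : cmon t (absPt r) = (absMonomial t r : ℂ) := by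
  simp [cmon, absPt, absMonomial]

theorem continuous_absPt : Continuous (absPt (g := g)) :=
  continuous_pi fun i => Complex.continuous_ofReal.comp
    (continuous_subtype_val.comp (continuous_apply i))

/-- The point of `T` with absolute values `r` and arguments `2πθ`, where `θ ∈ (ℝ/ℤ)^g`. -/
def polarPt (r : AbsT g) (θ : UnitAddTorus (Fin g)) : T g := fun i =>
  Units.mk0 (absPt r i * unitPt θ i)
    (mul_ne_zero (Complex.ofReal_ne_zero.2 (r i).2.ne') (unitPt_ne_zero θ i))

theorem coord_polarPt (r : AbsT g) (θ : UnitAddTorus (Fin g)) :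
    coord (polarPt r θ) = absPt r * unitPt θ := rfl

theorem varpi_polarPt (r : AbsT g) (θ : UnitAddTorus (Fin g)) : varpi g (polarPt r θ) = r := by
  funext i
  apply Subtype.ext
  change ‖absPt r i * unitPt θ i‖ = _
  rw [norm_mul, norm_unitPt, mul_one, absPt, Complex.norm_real, Real.norm_of_nonneg (r i).2.le]

theorem exists_polarPt_eq (x : T g) : ∃ θ, polarPt (varpi g x) θ = x := by
  have h0 : ∀ i, absPt (varpi g x) i ≠ 0 := fun i =>
    Complex.ofReal_ne_zero.2 (varpi g x i).2.ne'
  have hn : ∀ i, ‖absPt (varpi g x) i‖ = ‖(x i : ℂ)‖ := fun i => by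
    simp [absPt, varpi]
  obtain ⟨θ, hθ⟩ := exists_unitPt_eq (u := fun i => (x i : ℂ) / absPt (varpi g x) i)
    fun i => by rw [norm_div, hn, div_self (norm_ne_zero_iff.2 (x i).ne_zero)]
  refine ⟨θ, funext fun i => Units.ext ?_⟩
  change absPt (varpi g x) i * unitPt θ i = _
  rw [hθ, mul_div_cancel₀ _ (h0 i)]

theorem monomial_polarPt (t : That g) (r : AbsT g) (θ : UnitAddTorus (Fin g)) :
    (monomial t (polarPt r θ) : ℂ) = absMonomial t r * mFourier t θ := by
  rw [← cmon_coord, coord_polarPt, cmon_mul, cmon_absPt, cmon_unitPt]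

/-! ### Values and uniqueness of Laurent series -/

/-- The value at `x` of the Laurent series with coefficients `a`; meaningful where the series
converges absolutely. -/
def laurentEval (a : That g → ℂ) (x : T g) : ℂ := ∑' t, a t * (monomial t x : ℂ)

theorem LaurentSummable.norm_eval {a : That g → ℂ} {x : T g}
    (ha : LaurentSummable (varpi g x) a) : Summable fun t => ‖a t * (monomial t x : ℂ)‖ := by
  simpa only [norm_mul, norm_monomial] using! ha

theorem mFourierCoeff_mFourier (m n : Fin g → ℤ) :
    mFourierCoeff (mFourier m : UnitAddTorus (Fin g) → ℂ) n = if n = m then 1 else 0 := by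
  rw [← mFourierCoeff_toLp, ← mFourierBasis_repr]
  change mFourierBasis.repr (mFourierLp 2 m) n = _
  rw [← coe_mFourierBasis, HilbertBasis.repr_self]
  simp [lp.single_apply, Pi.single_apply]

/-- The Fourier coefficients of an absolutely convergent Fourier series. -/
theorem mFourierCoeff_tsum {a : That g → ℂ} (ha : Summable fun t => ‖a t‖) (n : That g) :
    mFourierCoeff (fun θ : UnitAddTorus (Fin g) => ∑' t, a t * mFourier t θ) n = a n := by
  have hint : ∀ t : That g, Integrable
      (fun θ => mFourier (-n) θ * (a t * mFourier t θ)) (haarTorus g) := fun t =>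
    integrable_of_continuous (by fun_prop)
  have hnorm : ∀ t θ, ‖mFourier (-n) θ * (a t * mFourier t θ)‖ = ‖a t‖ := by
    intro t θ
    have h1 : ∀ k : That g, ‖mFourier k θ‖ = 1 := fun k => by
      simp [← cmon_unitPt, cmon, norm_unitPt]
    rw [norm_mul, norm_mul, h1, h1, one_mul, mul_one]
  have h := hasSum_integral_of_summable_integral_norm hint (by
    simpa only [hnorm, integral_const, probReal_univ, one_smul] using ha)
  have e : ∀ t : That g, ∫ θ, mFourier (-n) θ * (a t * mFourier t θ) ∂haarTorus g =
      if t = n then a n else 0 := by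
    intro t
    have h1 : ∀ θ, mFourier (-n) θ * (a t * mFourier t θ) =
        a t * (mFourier (-n) θ • mFourier t θ) := fun θ => by
      rw [smul_eq_mul]; ring
    simp only [h1]
    rw [integral_const_mul]
    change a t * mFourierCoeff (mFourier t : UnitAddTorus (Fin g) → ℂ) n = _
    rw [mFourierCoeff_mFourier]
    by_cases ht : t = n
    · simp [ht]
    · simp [ht, Ne.symm ht]
  simp only [e] at h
  refine Eq.trans ?_ (h.unique (hasSum_ite_eq n (a n)))
  simp only [mFourierCoeff, smul_eq_mul, ← tsum_mul_left]
  rfl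

/-- A Laurent series is determined by its values on a torus on which it converges absolutely. -/
theorem laurentEval_injective {r : AbsT g} {a b : That g → ℂ} (ha : LaurentSummable r a)
    (hb : LaurentSummable r b)
    (h : ∀ x, varpi g x = r → laurentEval a x = laurentEval b x) : a = b := by
  -- the coefficients, weighted by the absolute values of the monomials, are Fourier coefficients
  have key : ∀ {c : That g → ℂ}, LaurentSummable r c → ∀ n,
      mFourierCoeff (fun θ => laurentEval c (polarPt r θ)) n = c n * absMonomial n r := by
    intro c hc n
    have h1 : (fun θ => laurentEval c (polarPt r θ)) =
        fun θ => ∑' t, (c t * absMonomial t r) * mFourier t θ := by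
      funext θ
      simp only [laurentEval, monomial_polarPt, mul_assoc]
    rw [h1]
    refine mFourierCoeff_tsum (a := fun t => c t * (absMonomial t r : ℂ)) ?_ n
    refine Summable.congr hc fun t => ?_
    rw [norm_mul, Complex.norm_real, Real.norm_of_nonneg (absMonomial_pos t r).le]
  funext n
  have h2 : (fun θ => laurentEval a (polarPt r θ)) = fun θ => laurentEval b (polarPt r θ) :=
    funext fun θ => h _ (varpi_polarPt r θ)
  have h3 := key ha n
  rw [h2, key hb n] at h3
  exact (mul_right_cancel₀ (Complex.ofReal_ne_zero.2 (absMonomial_pos n r).ne') h3).symm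

/-! ### Boxes in `|T|` -/

/-- The corners of the box of all `s` with `ρ⁻¹ ≤ s i / r i ≤ ρ` for all `i`. -/
def corner (ρ : {x : ℝ // 0 < x}) (r : AbsT g) (ε : Fin g → Bool) : AbsT g :=
  fun i => r i * if ε i then ρ else ρ⁻¹

theorem exists_box_subset {r : AbsT g} {N : Set (AbsT g)} (hN : N ∈ nhds r) :
    ∃ ρ : {x : ℝ // 0 < x}, 1 < (ρ : ℝ) ∧
      ∀ s : AbsT g, (∀ i, (r i : ℝ) * (ρ : ℝ)⁻¹ ≤ s i ∧ (s i : ℝ) ≤ r i * ρ) → s ∈ N := by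
  obtain ⟨ε, hε, hball⟩ := Metric.mem_nhds_iff.1 hN
  -- with `ρ = 1 + δ` the side lengths are controlled by `r i * δ ≤ ε / 2`; adding `1` to the sum
  -- keeps `R` positive when `g = 0`
  let R : ℝ := 1 + ∑ i, (r i : ℝ)
  have hsum : ∀ i, (r i : ℝ) ≤ ∑ i, (r i : ℝ) := fun i =>
    Finset.single_le_sum (f := fun i => (r i : ℝ)) (fun j _ => (r j).2.le) (Finset.mem_univ i)
  have hR : 0 < R := by
    have : 0 ≤ ∑ i, (r i : ℝ) := Finset.sum_nonneg fun j _ => (r j).2.le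
    positivity
  let δ : ℝ := ε / (2 * R)
  have hδ : 0 < δ := by positivity
  have hrδ : ∀ i, (r i : ℝ) * δ < ε := fun i => by
    have h1 : (r i : ℝ) * δ ≤ R * δ :=
      mul_le_mul_of_nonneg_right (by have := hsum i; simp only [R]; linarith) hδ.le
    have h2 : R * δ = ε / 2 := by simp only [δ]; field_simp
    linarith
  refine ⟨⟨1 + δ, by positivity⟩, by simpa using hδ, fun s hs => hball ?_⟩
  rw [Metric.mem_ball, dist_pi_lt_iff hε]
  intro i
  obtain ⟨h1, h2⟩ := hs i
  rw [Subtype.dist_eq, Real.dist_eq, abs_lt]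
  have hinv : 1 - δ ≤ (1 + δ)⁻¹ := by
    rw [← one_div, le_div_iff₀ (by positivity)]
    nlinarith [sq_nonneg δ]
  have h3 := mul_le_mul_of_nonneg_left hinv (r i).2.le
  have h4 := hrδ i
  simp only at h1 h2
  constructor <;> nlinarith

theorem corner_mem_box {ρ : {x : ℝ // 0 < x}} (hρ : 1 < (ρ : ℝ)) (r : AbsT g) (ε : Fin g → Bool)
    (i : Fin g) : (r i : ℝ) * (ρ : ℝ)⁻¹ ≤ corner ρ r ε i ∧ (corner ρ r ε i : ℝ) ≤ r i * ρ := by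
  have h1 : (ρ : ℝ)⁻¹ ≤ ρ := (inv_le_one_of_one_le₀ hρ.le).trans hρ.le
  have h2 := mul_le_mul_of_nonneg_left h1 (r i).2.le
  cases h : ε i <;> simp [corner, h, h2]

/-- On a box a monomial is bounded by the sum of its values at the corners. -/
theorem absMonomial_le_sum_corner {ρ : {x : ℝ // 0 < x}} {r s : AbsT g}
    (hs : ∀ i, (r i : ℝ) * (ρ : ℝ)⁻¹ ≤ s i ∧ (s i : ℝ) ≤ r i * ρ) (t : That g) :
    absMonomial t s ≤ ∑ ε, absMonomial t (corner ρ r ε) := by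
  have h1 : ∏ i, ∑ e : Bool, ((r i * if e then ρ else ρ⁻¹ : {x : ℝ // 0 < x}) : ℝ) ^ t i =
      ∑ ε : Fin g → Bool, absMonomial t (corner ρ r ε) := by
    classical
    rw [Fintype.prod_sum]; rfl
  rw [← h1]
  refine Finset.prod_le_prod (fun i _ => (zpow_pos (s i).2 _).le) fun i _ => ?_
  simp only [Fintype.sum_bool, if_true, Bool.false_eq_true, if_false, Positive.val_mul,
    Positive.coe_inv]
  have hp1 : 0 < (r i : ℝ) * (ρ : ℝ)⁻¹ := mul_pos (r i).2 (inv_pos.2 ρ.2)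
  have hp2 : 0 < (r i : ℝ) * ρ := mul_pos (r i).2 ρ.2
  rcases le_total 0 (t i) with ht | ht
  · exact (zpow_le_zpow_left₀ ht (s i).2.le (hs i).2).trans
      (le_add_of_nonneg_right (zpow_pos hp1 _).le)
  · refine le_trans ?_ (le_add_of_nonneg_left (zpow_pos hp2 _).le)
    obtain ⟨n, hn⟩ := Int.exists_eq_neg_ofNat ht
    rw [hn, zpow_neg, zpow_neg]
    exact inv_anti₀ (zpow_pos hp1 _)
      (zpow_le_zpow_left₀ (Int.natCast_nonneg n) hp1.le (hs i).1)

theorem summable_prod_of_summable {f : ℤ → ℝ} (hf : Summable f) (h0 : ∀ n, 0 ≤ f n) :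
    Summable fun t : Fin g → ℤ => ∏ i, f (t i) := by
  classical
  refine summable_of_sum_le (c := ∏ _i : Fin g, ∑' n, f n)
    (fun t => Finset.prod_nonneg fun i _ => h0 _) fun u => ?_
  calc ∑ t ∈ u, ∏ i, f (t i)
      ≤ ∑ t ∈ Fintype.piFinset fun i => u.image fun t => t i, ∏ i, f (t i) :=
        Finset.sum_le_sum_of_subset_of_nonneg
          (fun t ht => Fintype.mem_piFinset.2 fun i => Finset.mem_image_of_mem _ ht)
          fun t _ _ => Finset.prod_nonneg fun i _ => h0 _
    _ = ∏ i : Fin g, ∑ n ∈ u.image fun t => t i, f n := (Finset.prod_univ_sum _ _).symm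
    _ ≤ _ := Finset.prod_le_prod (fun i _ => Finset.sum_nonneg fun n _ => h0 n)
        fun i _ => hf.sum_le_tsum _ fun n _ => h0 n

/-- Coefficients that satisfy the Cauchy estimates at the corners of a box decay geometrically
relative to the centre of the box. -/
theorem laurentSummable_of_corner_le {ρ : {x : ℝ // 0 < x}} (hρ : 1 < (ρ : ℝ)) {r : AbsT g}
    {c : That g → ℂ} {M : ℝ} (hM : ∀ ε t, ‖c t‖ * absMonomial t (corner ρ r ε) ≤ M) :
    LaurentSummable r c := by
  have hq0 : 0 ≤ (ρ : ℝ)⁻¹ := (inv_pos.2 ρ.2).le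
  have hq1 : (ρ : ℝ)⁻¹ < 1 := inv_lt_one_of_one_lt₀ hρ
  have hgeo : Summable fun n : ℤ => ((ρ : ℝ)⁻¹) ^ n.natAbs := by
    refine Summable.of_nat_of_neg ?_ ?_ <;>
    simpa using summable_geometric_of_lt_one hq0 hq1
  have hs := (summable_prod_of_summable (g := g) hgeo fun n => pow_nonneg hq0 _).mul_left M
  refine Summable.of_nonneg_of_le
    (fun t => mul_nonneg (norm_nonneg _) (absMonomial_pos t r).le) (fun t => ?_) hs
  -- the corner at which the monomial `t` is largest
  let ε : Fin g → Bool := fun i => decide (0 ≤ t i)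
  have h1 : absMonomial t r = absMonomial t (corner ρ r ε) * ∏ i, ((ρ : ℝ)⁻¹) ^ (t i).natAbs := by
    simp only [absMonomial, ← Finset.prod_mul_distrib]
    refine Finset.prod_congr rfl fun i _ => ?_
    have hρ0 : (ρ : ℝ) ≠ 0 := ρ.2.ne'
    by_cases ht : 0 ≤ t i
    · obtain ⟨n, hn⟩ := Int.eq_ofNat_of_zero_le ht
      simp only [corner, ε, ht, decide_true, if_true, Positive.val_mul]
      rw [hn]
      simp only [Int.natAbs_natCast, zpow_natCast]
      rw [← mul_pow, mul_assoc, mul_inv_cancel₀ hρ0, mul_one]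
    · obtain ⟨n, hn⟩ := Int.exists_eq_neg_ofNat (not_le.1 ht).le
      simp only [corner, ε, ht, decide_false, Bool.false_eq_true, if_false, Positive.val_mul,
        Positive.coe_inv]
      rw [hn]
      simp only [Int.natAbs_neg, Int.natAbs_natCast, zpow_neg, zpow_natCast]
      rw [mul_pow, mul_inv, mul_assoc, inv_mul_cancel₀ (pow_ne_zero _ (inv_ne_zero hρ0)), mul_one]
  rw [h1, ← mul_assoc]
  exact mul_le_mul_of_nonneg_right (hM ε t) (Finset.prod_nonneg fun i _ => pow_nonneg hq0 _)

/-! ### Laurent series and holomorphic functions -/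

theorem differentiableAt_cmon (t : That g) {z : Fin g → ℂ} (hz : ∀ i, z i ≠ 0) :
    DifferentiableAt ℂ (cmon t) z := by
  unfold cmon
  exact (HasFDerivAt.finsetProd fun i _ =>
    ((differentiableAt_apply (𝕜 := ℂ) i z).zpow (m := t i)
      (Or.inl (hz i))).hasFDerivAt).differentiableAt

variable (D : Opens (AbsT g))

theorem isOpen_coord_image : IsOpen (coord '' (varpi g ⁻¹' D)) :=
  isOpenEmbedding_coord.isOpenMap _ (D.2.preimage (continuous_varpi g))

theorem absPt_mul_unitPt_mem {D : Opens (AbsT g)} {r : AbsT g} (hr : r ∈ D)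
    (θ : UnitAddTorus (Fin g)) : absPt r * unitPt θ ∈ coord '' (varpi g ⁻¹' D) :=
  ⟨polarPt r θ, by rw [Set.mem_preimage, varpi_polarPt]; exact hr, coord_polarPt r θ⟩

theorem absPt_mem {D : Opens (AbsT g)} {r : AbsT g} (hr : r ∈ D) :
    absPt r ∈ coord '' (varpi g ⁻¹' D) := by
  simpa [unitPt_zero] using absPt_mul_unitPt_mem hr 0

theorem isReinhardt_coord_image : IsReinhardt (coord '' (varpi g ⁻¹' D)) where
  ne_zero := by rintro _ ⟨x, -, rfl⟩ i; exact (x i).ne_zero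
  mul_mem := by
    rintro _ ⟨x, hx, rfl⟩ θ
    obtain ⟨φ, hφ⟩ := exists_polarPt_eq x
    rw [← hφ, coord_polarPt, mul_assoc, ← unitPt_add]
    exact absPt_mul_unitPt_mem hx _

variable {D} {G : (Fin g → ℂ) → ℂ}

/-- The `t`-th Laurent coefficient of `G` on the torus of radii `r`, as the mean value of
`G(z) z ^ (-t)` over this torus. -/
def laurentCoeff (G : (Fin g → ℂ) → ℂ) (r : AbsT g) (t : That g) : ℂ :=
  torusAverage (fun z => G z * cmon (-t) z) (absPt r)

theorem mFourierCoeff_orbit (r : AbsT g) (t : That g) :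
    mFourierCoeff (fun θ => G (absPt r * unitPt θ)) t = laurentCoeff G r t * absMonomial t r := by
  rw [laurentCoeff, torusAverage, ← integral_mul_const]
  change ∫ θ, mFourier (-t) θ • G (absPt r * unitPt θ) ∂haarTorus g = _
  refine integral_congr_ae (Filter.Eventually.of_forall fun θ => ?_)
  have h0 : (absMonomial t r : ℂ) ≠ 0 := Complex.ofReal_ne_zero.2 (absMonomial_pos t r).ne'
  simp only [cmon_mul, cmon_unitPt, smul_eq_mul, cmon_neg t (absPt r), cmon_absPt]
  field_simp

/-- The Cauchy estimates for the Laurent coefficients. -/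
theorem exists_laurentCoeff_bound (hG : ContinuousOn G (coord '' (varpi g ⁻¹' D))) {r : AbsT g}
    (hr : r ∈ D) : ∃ M : ℝ, ∀ t, ‖laurentCoeff G r t‖ * absMonomial t r ≤ M := by
  have hc : Continuous fun θ => G (absPt r * unitPt θ) :=
    continuous_orbit (isReinhardt_coord_image D) hG (absPt_mem hr)
  obtain ⟨M, hM⟩ := isCompact_univ.exists_bound_of_continuousOn hc.continuousOn
  refine ⟨M, fun t => ?_⟩
  have h1 : ‖laurentCoeff G r t‖ * absMonomial t r =
      ‖mFourierCoeff (fun θ => G (absPt r * unitPt θ)) t‖ := by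
    rw [mFourierCoeff_orbit, norm_mul, Complex.norm_real,
      Real.norm_of_nonneg (absMonomial_pos t r).le]
  rw [h1]
  change ‖∫ θ, mFourier (-t) θ • G (absPt r * unitPt θ) ∂haarTorus g‖ ≤ M
  refine (norm_integral_le_of_norm_le_const (C := M)
    (Filter.Eventually.of_forall fun θ => ?_)).trans (by simp)
  rw [norm_smul, ← cmon_unitPt]
  have : ‖cmon (-t) (unitPt θ)‖ = 1 := by simp [cmon, norm_unitPt]
  rw [this, one_mul]
  exact hM θ (Set.mem_univ _)

/-- A neighbourhood of `r` on which all Laurent coefficients are constant. -/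
theorem laurentCoeff_eventually_eq (hG : DifferentiableOn ℂ G (coord '' (varpi g ⁻¹' D)))
    {r : AbsT g} (hr : r ∈ D) :
    ∀ᶠ s in nhds r, s ∈ D ∧ laurentCoeff G s = laurentCoeff G r := by
  obtain ⟨ε, hε, hball⟩ := Metric.isOpen_iff.1 (isOpen_coord_image D) _ (absPt_mem hr)
  filter_upwards [D.2.mem_nhds hr,
    continuous_absPt.continuousAt.preimage_mem_nhds (Metric.ball_mem_nhds (absPt r) hε)]
    with s hs hs'
  refine ⟨hs, funext fun t => ?_⟩
  refine torusAverage_eq_of_mem_ball (isReinhardt_coord_image D) (isOpen_coord_image D)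
    (hG.mul fun z hz => ?_) hball hs'
  exact (differentiableAt_cmon (-t)
    ((isReinhardt_coord_image D).ne_zero z hz)).differentiableWithinAt

theorem laurentSummable_laurentCoeff (hG : DifferentiableOn ℂ G (coord '' (varpi g ⁻¹' D)))
    {r : AbsT g} (hr : r ∈ D) : LaurentSummable r (laurentCoeff G r) := by
  obtain ⟨ρ, hρ, hbox⟩ := exists_box_subset (laurentCoeff_eventually_eq hG hr)
  have hcor : ∀ ε, corner ρ r ε ∈ D ∧ laurentCoeff G (corner ρ r ε) = laurentCoeff G r :=
    fun ε => hbox _ (corner_mem_box hρ r ε)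
  choose M hM using fun ε => exists_laurentCoeff_bound hG.continuousOn (hcor ε).1
  obtain ⟨M', hM'⟩ := Finset.exists_le (Finset.univ.image M)
  refine laurentSummable_of_corner_le hρ (M := M') fun ε t => ?_
  rw [← (hcor ε).2]
  exact (hM ε t).trans (hM' _ (Finset.mem_image_of_mem _ (Finset.mem_univ ε)))

/-- A holomorphic function on `ϖ⁻¹(D)` is the sum of its Laurent series. -/
theorem eq_laurentEval_laurentCoeff (hG : DifferentiableOn ℂ G (coord '' (varpi g ⁻¹' D)))
    {x : T g} (hx : varpi g x ∈ D) :
    G (coord x) = laurentEval (laurentCoeff G (varpi g x)) x := by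
  let f : C(UnitAddTorus (Fin g), ℂ) := ⟨fun θ => G (absPt (varpi g x) * unitPt θ),
    continuous_orbit (isReinhardt_coord_image D) hG.continuousOn (absPt_mem hx)⟩
  have hf : ∀ t, mFourierCoeff f t =
      laurentCoeff G (varpi g x) t * absMonomial t (varpi g x) := mFourierCoeff_orbit _
  have hsum : Summable (mFourierCoeff f) := by
    refine Summable.of_norm ((laurentSummable_laurentCoeff hG hx).congr fun t => ?_)
    rw [hf, norm_mul, Complex.norm_real, Real.norm_of_nonneg (absMonomial_pos t _).le]
  obtain ⟨θ, hθ⟩ := exists_polarPt_eq x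
  have h1 := (hasSum_mFourier_series_apply_of_summable hsum θ).tsum_eq
  have h2 : f θ = G (coord x) := by
    conv_rhs => rw [← hθ]
    rfl
  rw [← h2, ← h1, laurentEval]
  refine tsum_congr fun t => ?_
  conv_rhs => rw [← hθ]
  rw [monomial_polarPt, varpi_polarPt, hf, smul_eq_mul, mul_assoc]

/-- The Laurent coefficients of a holomorphic function form a section of the Laurent sheaf. -/
theorem laurentCoeff_mem_laurent (hG : DifferentiableOn ℂ G (coord '' (varpi g ⁻¹' D))) :
    (fun r : D => laurentCoeff G r) ∈ laurent D := by
  refine ⟨(IsLocallyConstant.iff_eventually_eq _).2 fun r => ?_, fun r =>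
    laurentSummable_laurentCoeff hG r.2⟩
  filter_upwards [continuous_subtype_val.continuousAt.eventually
    (laurentCoeff_eventually_eq hG r.2)] with s hs using hs.2

/-- Local constancy of a Laurent section, as a statement about neighbourhoods in `|T|`. -/
theorem laurent_eventually_eq {a : D → That g → ℂ} (ha : a ∈ laurent D) (r : D) :
    ∀ᶠ s in nhds (r : AbsT g), ∃ hs : s ∈ D, a ⟨s, hs⟩ = a r := by
  have h1 := (IsLocallyConstant.iff_eventually_eq a).1 ha.1 r
  rw [← D.2.isOpenEmbedding_subtypeVal.map_nhds_eq r, Filter.eventually_map]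
  filter_upwards [h1] with y hy using ⟨y.2, hy⟩

/-- The sum of a convergent Laurent series on `D` is holomorphic on `ϖ⁻¹(D)`. -/
theorem isHolomorphic_laurentEval {a : D → That g → ℂ} (ha : a ∈ laurent D) :
    IsHolomorphic (S := varpi g ⁻¹' D) fun x => laurentEval (a ⟨varpi g x, x.2⟩) x := by
  refine isHolomorphic_of_local _ fun x hx => ?_
  let r : D := ⟨varpi g x, hx⟩
  obtain ⟨ρ, hρ, hbox⟩ := exists_box_subset (laurent_eventually_eq ha r)
  let B : Set (AbsT g) :=
    {s | ∀ i, ((r : AbsT g) i : ℝ) * (ρ : ℝ)⁻¹ < s i ∧ (s i : ℝ) < (r : AbsT g) i * ρ}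
  have hB : IsOpen B := by
    simp only [B, Set.ofPred_forall, Set.ofPred_and]
    refine isOpen_iInter_of_finite fun i => ?_
    have hc : Continuous fun s : AbsT g => (s i : ℝ) :=
      continuous_subtype_val.comp (continuous_apply i)
    exact (isOpen_lt continuous_const hc).inter (isOpen_lt hc continuous_const)
  have hB' : ∀ s ∈ B, ∃ hs : s ∈ D, a ⟨s, hs⟩ = a r := fun s hs =>
    hbox s fun i => ⟨(hs i).1.le, (hs i).2.le⟩
  have hxB : varpi g x ∈ B := fun i => by
    have h0 := ((r : AbsT g) i).2
    exact ⟨mul_lt_of_lt_one_right h0 (inv_lt_one_of_one_lt₀ hρ), lt_mul_of_one_lt_right h0 hρ⟩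
  refine ⟨varpi g ⁻¹' B, hB.preimage (continuous_varpi g), hxB, fun y hy => (hB' _ hy).1,
    fun z => ∑' t, a r t * cmon t z, ?_, fun y => ?_⟩
  · have hu : Summable fun t => ∑ ε, ‖a r t‖ * absMonomial t (corner ρ (r : AbsT g) ε) := by
      refine summable_sum fun ε _ => ?_
      obtain ⟨hs, hs'⟩ := hbox _ (corner_mem_box hρ (r : AbsT g) ε)
      rw [← hs']
      exact ha.2 ⟨_, hs⟩
    refine differentiableOn_tsum_of_norm_le hu (isOpen_coord_image ⟨B, hB⟩)
      (fun t z hz => ?_) ?_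
    · exact ((differentiableAt_cmon t
        ((isReinhardt_coord_image ⟨B, hB⟩).ne_zero z hz)).const_mul _).differentiableWithinAt
    · rintro t _ ⟨y, hy, rfl⟩
      rw [norm_mul, cmon_coord, norm_monomial, ← Finset.mul_sum]
      exact mul_le_mul_of_nonneg_left
        (absMonomial_le_sum_corner (fun i => ⟨(hy i).1.le, (hy i).2.le⟩) t) (norm_nonneg _)
  · change laurentEval (a ⟨varpi g y, _⟩) y = _
    rw [(hB' _ y.2).2]
    simp only [laurentEval, cmon_coord]

end expansion

/-! ### Twisting coefficients by a cochain -/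

section twist

/-- Multiplication of the coefficients of a Laurent series by a `U(1)`-valued 1-cochain. -/
def twist (α : That g → Circle) (a : That g → ℂ) : That g → ℂ := fun t => (α t : ℂ) * a t

variable (α : That g → Circle)

theorem laurentSummable_twist {r : AbsT g} {a : That g → ℂ} (ha : LaurentSummable r a) :
    LaurentSummable r (twist α a) :=
  ha.congr fun t => by rw [twist, norm_mul, Circle.norm_coe, one_mul]

theorem twist_inv_twist (a : That g → ℂ) : twist α (twist α⁻¹ a) = a := by
  funext t
  simp [twist, Circle.coe_ne_zero]

theorem twist_injective : Function.Injective (twist α) := fun _ _ h => funext fun t =>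
  mul_left_cancel₀ (Circle.coe_ne_zero (α t)) (congrFun h t)

theorem twist_mem_laurent {D : Opens (AbsT g)} {a : D → That g → ℂ} (ha : a ∈ laurent D) :
    (fun r => twist α (a r)) ∈ laurent D :=
  ⟨ha.1.comp (twist α), fun r => laurentSummable_twist α (ha.2 r)⟩

end twist

/-! ### The star product of functions in terms of Laurent series -/

section star

variable {Γ : Subgroup (T g)} {lam : UnitaryParameter g} [lam.IsTorsion]

theorem varpi_mul_K (x : T g) (κ : lam.K) : varpi g (x * κ) = varpi g x := by
  rw [map_mul, lam.varpi_eq_one κ.2, mul_one]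

open Classical in
/-- If `f` is given on the `K`-orbit of `x` by a Laurent series, then its projection to `L_k` is
given by the terms whose exponent represents `k`. -/
theorem proj_apply_eq_tsum {V : Opens (Y Γ lam)} (f : OX Γ (piPre lam V)) {c : That g → ℂ}
    {x : T g} (hx : toX Γ x ∈ piPre lam V) (hc : LaurentSummable (varpi g x) c)
    (hf : ∀ κ : lam.K, f.1 ⟨toX Γ x * toX Γ κ, mul_mem_piPre hx κ⟩ = laurentEval c (x * κ))
    (k : lam.Khat) :
    (proj lam V k f).1 ⟨toX Γ x, hx⟩ =
      ∑' t : That g, if (t : lam.Khat) = k then c t * (monomial t x : ℂ) else 0 := by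
  have h1 : (proj lam V k f).1 ⟨toX Γ x, hx⟩ = (Fintype.card lam.K : ℂ)⁻¹ *
      ∑ κ : lam.K, ((lam.chr k κ)⁻¹ : ℂˣ).val * laurentEval c (x * κ) := by
    rw [proj_apply]
    simp only [Subalgebra.coe_smul, AddSubmonoidClass.coe_finsetSum, Pi.smul_apply,
      Finset.sum_apply, smul_eq_mul]
    congr 1
    exact Finset.sum_congr rfl fun κ _ => congrArg _ (hf κ)
  have hs : ∀ κ : lam.K, Summable fun t => c t * (monomial t (x * κ) : ℂ) := fun κ =>
    Summable.of_norm (LaurentSummable.norm_eval (by rwa [varpi_mul_K]))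
  rw [h1]
  simp only [laurentEval, ← tsum_mul_left]
  rw [← Summable.tsum_finsetSum fun κ _ => (hs κ).mul_left _, ← tsum_mul_left]
  refine tsum_congr fun t => ?_
  have h2 : ∀ κ : lam.K, ((lam.chr k κ)⁻¹ : ℂˣ).val * (c t * (monomial t (x * κ) : ℂ)) =
      (c t * (monomial t x : ℂ)) * (lam.chr ((t : lam.Khat) - k) κ : ℂ) := fun κ => by
    rw [map_mul, sub_eq_add_neg, UnitaryParameter.chr_add, chr_neg, UnitaryParameter.chr_mk]
    push_cast
    ring
  simp only [h2]
  rw [← Finset.mul_sum, UnitaryParameter.sum_chr_right]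
  simp only [sub_eq_zero]
  split_ifs with h
  · field_simp [lam.card_K_ne_zero]
  · simp

open Classical in
/-- A bilinear combination of the partial sums over the fibres of `q`, as a sum over pairs. -/
theorem sum_mul_tsum_fiber {ι κ : Type*} [Fintype κ] (q : ι → κ) (β : κ → κ → ℂ) {f h : ι → ℂ}
    (hf : Summable fun t => ‖f t‖) (hh : Summable fun t => ‖h t‖) :
    ∑ k₁, ∑ k₂, β k₁ k₂ *
        ((∑' t, if q t = k₁ then f t else 0) * ∑' t, if q t = k₂ then h t else 0) =
      ∑' p : ι × ι, β (q p.1) (q p.2) * (f p.1 * h p.2) := by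
  have hsum : ∀ {e : ι → ℂ} (k : κ), (Summable fun t => ‖e t‖) →
      Summable fun t => ‖if q t = k then e t else 0‖ := fun k he =>
    Summable.of_nonneg_of_le (fun _ => norm_nonneg _) (fun t => by split_ifs <;> simp) he
  have hprod : ∀ k₁ k₂, HasSum (fun p : ι × ι => β k₁ k₂ *
      ((if q p.1 = k₁ then f p.1 else 0) * if q p.2 = k₂ then h p.2 else 0))
      (β k₁ k₂ * ((∑' t, if q t = k₁ then f t else 0) * ∑' t, if q t = k₂ then h t else 0)) :=
    fun k₁ k₂ => by
      rw [tsum_mul_tsum_of_summable_norm (hsum k₁ hf) (hsum k₂ hh)]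
      exact (summable_mul_of_summable_norm (hsum k₁ hf) (hsum k₂ hh)).hasSum.mul_left _
  rw [← (hasSum_sum fun k₁ _ => hasSum_sum fun k₂ _ => hprod k₁ k₂).tsum_eq]
  refine tsum_congr fun p => ?_
  simp only [ite_mul, mul_ite, zero_mul, mul_zero, Finset.sum_ite_eq, Finset.mem_univ, if_true]

/-- The star product of two functions given by Laurent series on the `K`-orbit of `x`. -/
theorem star_apply_eq_tsum (b : BilinearRep lam) {V : Opens (Y Γ lam)}
    (φ ψ : OX Γ (piPre lam V)) {c d : That g → ℂ} {x : T g} (hx : toX Γ x ∈ piPre lam V)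
    (hc : LaurentSummable (varpi g x) c) (hd : LaurentSummable (varpi g x) d)
    (hφ : ∀ κ : lam.K, φ.1 ⟨toX Γ x * toX Γ κ, mul_mem_piPre hx κ⟩ = laurentEval c (x * κ))
    (hψ : ∀ κ : lam.K, ψ.1 ⟨toX Γ x * toX Γ κ, mul_mem_piPre hx κ⟩ = laurentEval d (x * κ)) :
    (star b V φ ψ).1 ⟨toX Γ x, hx⟩ = ∑' p : That g × That g,
      b.val p.1 p.2 * ((c p.1 * (monomial p.1 x : ℂ)) * (d p.2 * (monomial p.2 x : ℂ))) := by
  classical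
  have h1 : (star b V φ ψ).1 ⟨toX Γ x, hx⟩ = ∑ k₁ : lam.Khat, ∑ k₂ : lam.Khat,
      b.val k₁ k₂ * ((proj lam V k₁ φ).1 ⟨toX Γ x, hx⟩ * (proj lam V k₂ ψ).1 ⟨toX Γ x, hx⟩) := by
    rw [star_apply]
    simp only [Subalgebra.coe_smul, AddSubmonoidClass.coe_finsetSum, Pi.smul_apply,
      Finset.sum_apply, smul_eq_mul, Subalgebra.coe_mul, Pi.mul_apply]
  rw [h1, ← sum_mul_tsum_fiber (fun t : That g => (t : lam.Khat)) b.val hc.norm_eval hd.norm_eval]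
  refine Finset.sum_congr rfl fun k₁ _ => Finset.sum_congr rfl fun k₂ _ => ?_
  rw [proj_apply_eq_tsum φ hx hc hφ, proj_apply_eq_tsum ψ hx hd hψ]
  congr!

end star

section iso

variable {Γ : Subgroup (T g)} {lam : UnitaryParameter g} {b : BilinearRep lam}

/-- The 1-cochain `α` has as coboundary the quotient of `λ` by the pullback of the bilinear map
`b` to the character lattice. -/
def IsCobounding (b : BilinearRep lam) (α : That g → Circle) : Prop :=
  ∀ s t : That g, lam s t = (b.toHom s t).toMul * α s * α t * (α (s + t))⁻¹

variable {α : That g → Circle}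

theorem IsCobounding.mul_eq (hα : IsCobounding b α) (s t : That g) :
    (α (s + t) : ℂ) * (lam s t : ℂ) = b.val s t * (α s : ℂ) * (α t : ℂ) := by
  rw [hα s t, BilinearRep.val]
  push_cast
  field_simp [Circle.coe_ne_zero]

theorem IsCobounding.zero (hα : IsCobounding b α) : lam 0 0 = α 0 := by
  have h := hα 0 0
  rw [add_zero, mul_assoc, mul_inv_cancel, mul_one] at h
  simpa using h

theorem norm_val (b : BilinearRep lam) (k l : lam.Khat) : ‖b.val k l‖ = 1 := Circle.norm_coe _

/-- The twist by `α` carries the star product of `λ` to that of `b`. -/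
theorem laurentEval_twist_star (hα : IsCobounding b α) {x : T g} {a a' : That g → ℂ}
    (ha : LaurentSummable (varpi g x) a) (ha' : LaurentSummable (varpi g x) a') :
    laurentEval (twist α (laurentStar lam a a')) x = ∑' p : That g × That g,
      b.val p.1 p.2 * ((twist α a p.1 * (monomial p.1 x : ℂ)) *
        (twist α a' p.2 * (monomial p.2 x : ℂ))) := by
  -- pairs of exponents `(s, t - s)`, grouped by their sum `t`
  let e : That g × That g ≃ That g × That g :=
    { toFun := fun p => (p.2, p.1 - p.2)
      invFun := fun q => (q.1 + q.2, q.1)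
      left_inv := fun p => by ext <;> simp
      right_inv := fun q => by ext <;> simp }
  let P : That g × That g → ℂ := fun p => b.val p.1 p.2 *
    ((twist α a p.1 * (monomial p.1 x : ℂ)) * (twist α a' p.2 * (monomial p.2 x : ℂ)))
  have hP : Summable P := by
    have h := summable_mul_of_summable_norm' (laurentSummable_twist α ha).norm_eval
      (Summable.of_norm (laurentSummable_twist α ha).norm_eval)
      (laurentSummable_twist α ha').norm_eval
      (Summable.of_norm (laurentSummable_twist α ha').norm_eval)
    refine Summable.of_norm (h.norm.congr fun p => ?_)
    simp only [P]
    rw [norm_mul (b.val _ _), norm_val, one_mul]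
  have hPe : Summable (P ∘ e) := e.summable_iff.2 hP
  change _ = ∑' p, P p
  rw [← e.tsum_eq P]
  change _ = ∑' p, (P ∘ e) p
  rw [hPe.tsum_prod]
  refine tsum_congr fun t => ?_
  rw [twist, laurentStar, ← tsum_mul_left, ← tsum_mul_right]
  refine tsum_congr fun s => ?_
  have h1 := hα.mul_eq s (t - s)
  rw [add_sub_cancel] at h1
  have h2 : (monomial t x : ℂ) = monomial s x * monomial (t - s) x := by
    rw [← Units.val_mul, ← MonoidHom.mul_apply, ← monomial_add, add_sub_cancel]
  simp only [Function.comp, P, e, Equiv.coe_fn_mk, twist]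
  rw [h2]
  linear_combination (a s * a' (t - s) * (monomial s x : ℂ) * (monomial (t - s) x : ℂ)) * h1

theorem laurentEval_twist_one (hα : IsCobounding b α) (x : T g) :
    laurentEval (twist α (laurentOne lam)) x = 1 := by
  rw [laurentEval, tsum_eq_single 0]
  · simp [twist, laurentOne, hα.zero, monomial_zero, Circle.coe_ne_zero]
  · intro t ht; simp [twist, laurentOne, ht]

theorem laurentEval_add {x : T g} {a a' : That g → ℂ} (ha : LaurentSummable (varpi g x) a)
    (ha' : LaurentSummable (varpi g x) a') :
    laurentEval (a + a') x = laurentEval a x + laurentEval a' x := by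
  simp only [laurentEval, Pi.add_apply, add_mul]
  exact (Summable.of_norm ha.norm_eval).tsum_add (Summable.of_norm ha'.norm_eval)

theorem laurentEval_smul (z : ℂ) (a : That g → ℂ) (x : T g) :
    laurentEval (z • a) x = z * laurentEval a x := by
  simp only [laurentEval, Pi.smul_apply, smul_eq_mul, mul_assoc, tsum_mul_left]

theorem twist_add (a a' : That g → ℂ) : twist α (a + a') = twist α a + twist α a' :=
  funext fun _ => mul_add _ _ _

theorem twist_smul (z : ℂ) (a : That g → ℂ) : twist α (z • a) = z • twist α a :=
  funext fun _ => mul_left_comm _ _ _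

theorem toX_surjective (Γ : Subgroup (T g)) : Function.Surjective (toX Γ) :=
  QuotientGroup.mk'_surjective Γ

/-! ### The isomorphism on sections -/

variable {U : Opens (AbsX Γ)}

variable (α)

/-- The value at a point over `U` of an invariant section of `𝒪_{𝖳_λ}`, after twisting by `α`. -/
def evalSection (a : ncSections Γ lam U) (x : T g) (hx : varpi g x ∈ absPre Γ U) : ℂ :=
  laurentEval (twist α (a.1.1 ⟨varpi g x, hx⟩)) x

/-- Invariance of the section under `Γ` makes its sum a `Γ`-invariant function on `T`. -/
theorem evalSection_mul_of_mem (a : ncSections Γ lam U) {x γ : T g} (hγ : γ ∈ Γ)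
    (hx : varpi g x ∈ absPre Γ U) (hxγ : varpi g (x * γ) ∈ absPre Γ U) :
    evalSection α a (x * γ) hxγ = evalSection α a x hx := by
  have e : varpi g (x * γ) * (varpi g γ)⁻¹ = varpi g x := by
    rw [map_mul, mul_inv_cancel_right]
  refine tsum_congr fun t => ?_
  have h := a.2 γ hγ _ hxγ (by rwa [e]) t
  have e' : (⟨varpi g (x * γ) * (varpi g γ)⁻¹, by rwa [e]⟩ : absPre Γ U) = ⟨varpi g x, hx⟩ :=
    Subtype.ext e
  rw [e'] at h
  rw [twist, twist, h, map_mul]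
  push_cast
  field_simp

theorem evalSection_congr (a : ncSections Γ lam U) {x y : T g} (h : toX Γ x = toX Γ y)
    (hx : varpi g x ∈ absPre Γ U) (hy : varpi g y ∈ absPre Γ U) :
    evalSection α a x hx = evalSection α a y hy := by
  have hm : x⁻¹ * y ∈ Γ := QuotientGroup.eq.1 h
  have e : x * (x⁻¹ * y) = y := mul_inv_cancel_left x y
  rw [← evalSection_mul_of_mem α a hm hx (by rwa [e])]
  congr 1

variable [lam.IsTorsion]

/-- The preimage in `Y` of an open subset of `|X|`. -/
abbrev preY (Γ : Subgroup (T g)) (lam : UnitaryParameter g) [lam.IsTorsion]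
    (U : Opens (AbsX Γ)) : Opens (Y Γ lam) :=
  (Opens.map (varpiYHom Γ lam)).obj U

theorem toX_mem_iff {x : T g} : toX Γ x ∈ piPre lam (preY Γ lam U) ↔ varpi g x ∈ absPre Γ U :=
  Iff.rfl

theorem varpi_surjInv_mem {w : X Γ} (hw : w ∈ piPre lam (preY Γ lam U)) :
    varpi g (Function.surjInv (toX_surjective Γ) w) ∈ absPre Γ U := by
  have h := toX_mem_iff (lam := lam) (U := U) (x := Function.surjInv (toX_surjective Γ) w)
  rw [Function.surjInv_eq (toX_surjective Γ) w] at h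
  exact h.1 hw

/-- The holomorphic function on an open subset of `X` defined by an invariant section of
`𝒪_{𝖳_λ}`, after twisting by `α`. -/
def evalX (a : ncSections Γ lam U) : OX Γ (piPre lam (preY Γ lam U)) :=
  ⟨fun w => evalSection α a (Function.surjInv (toX_surjective Γ) w)
      (varpi_surjInv_mem w.2), by
    obtain ⟨F, hF, hF'⟩ := isHolomorphic_laurentEval (twist_mem_laurent α a.1.2)
    refine ⟨F, hF, fun x => (evalSection_congr α a ?_ _ x.2).trans (hF' x)⟩
    exact Function.surjInv_eq _ _⟩

theorem evalX_apply (a : ncSections Γ lam U) {x : T g}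
    (hx : toX Γ x ∈ piPre lam (preY Γ lam U)) :
    (evalX α a).1 ⟨toX Γ x, hx⟩ = laurentEval (twist α (a.1.1 ⟨varpi g x, hx⟩)) x :=
  evalSection_congr α a (Function.surjInv_eq _ _) _ hx

/-- Points in one `K`-orbit have the same absolute values, so that the same Laurent series computes
`evalX` on the whole orbit. -/
theorem evalX_apply_mul_K (a : ncSections Γ lam U) {x : T g}
    (hx : toX Γ x ∈ piPre lam (preY Γ lam U)) (κ : lam.K) :
    (evalX α a).1 ⟨toX Γ x * toX Γ κ, mul_mem_piPre hx κ⟩ =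
      laurentEval (twist α (a.1.1 ⟨varpi g x, hx⟩)) (x * κ) := by
  exact (evalX_apply α a (x := x * κ) (mul_mem_piPre hx κ)).trans (congrArg
    (fun r => laurentEval (twist α (a.1.1 r)) (x * κ)) (Subtype.ext (varpi_mul_K x κ)))

theorem OX_ext {W : Opens (X Γ)} {φ ψ : OX Γ W}
    (h : ∀ x (hx : toX Γ x ∈ W), φ.1 ⟨toX Γ x, hx⟩ = ψ.1 ⟨toX Γ x, hx⟩) : φ = ψ := by
  apply Subtype.ext
  funext ⟨w, hw⟩
  obtain ⟨x, rfl⟩ := toX_surjective Γ w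
  exact h x hw

theorem evalX_add (a a' : ncSections Γ lam U) : evalX α (a + a') = evalX α a + evalX α a' := by
  refine OX_ext fun x hx => ?_
  have h := laurentEval_add (laurentSummable_twist α (a.1.2.2 ⟨varpi g x, hx⟩))
    (laurentSummable_twist α (a'.1.2.2 ⟨varpi g x, hx⟩))
  rw [← twist_add, ← evalX_apply α a hx, ← evalX_apply α a' hx] at h
  exact (evalX_apply α (a + a') hx).trans h

theorem evalX_smul (z : ℂ) (a : ncSections Γ lam U) : evalX α (z • a) = z • evalX α a := by
  refine OX_ext fun x hx => ?_
  have h := laurentEval_smul z (twist α (a.1.1 ⟨varpi g x, hx⟩)) x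
  rw [← twist_smul, ← evalX_apply α a hx] at h
  exact (evalX_apply α (z • a) hx).trans h

variable {α}

theorem evalX_one (hα : IsCobounding b α) : evalX α (1 : ncSections Γ lam U) = 1 :=
  OX_ext fun x hx => (evalX_apply α 1 hx).trans (laurentEval_twist_one hα x)

theorem evalX_mul (hα : IsCobounding b α) (a a' : ncSections Γ lam U) :
    evalX α (a * a') = star b (preY Γ lam U) (evalX α a) (evalX α a') := by
  refine OX_ext fun x hx => (evalX_apply α (a * a') hx).trans ?_
  have h1 := a.1.2.2 ⟨varpi g x, hx⟩
  have h2 := a'.1.2.2 ⟨varpi g x, hx⟩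
  rw [star_apply_eq_tsum b (evalX α a) (evalX α a') hx (laurentSummable_twist α h1)
    (laurentSummable_twist α h2) (evalX_apply_mul_K α a hx) (evalX_apply_mul_K α a' hx)]
  exact laurentEval_twist_star hα h1 h2

/-- `evalX` as a homomorphism of algebras. -/
def evalHom (hα : IsCobounding b α) (U : Opens (AbsX Γ)) :
    ncSections Γ lam U →ₐ[ℂ] StarSections Γ b (preY Γ lam U) :=
  AlgHom.ofLinearMap
    { toFun := evalX α
      map_add' := evalX_add α
      map_smul' := evalX_smul α }
    (evalX_one hα) (evalX_mul hα)

variable (α)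

theorem evalX_injective : Function.Injective (evalX (U := U) (Γ := Γ) (lam := lam) α) := by
  intro a a' h
  apply Subtype.ext
  apply Subtype.ext
  funext ⟨r, hr⟩
  apply twist_injective α
  refine laurentEval_injective (laurentSummable_twist α (a.1.2.2 ⟨r, hr⟩))
    (laurentSummable_twist α (a'.1.2.2 ⟨r, hr⟩)) ?_
  rintro x rfl
  rw [← evalX_apply α a hr, ← evalX_apply α a' hr, h]

/-- The preimage of a function has as coefficients its Laurent coefficients, untwisted by `α⁻¹`. -/
theorem evalX_surjective : Function.Surjective (evalX (U := U) (Γ := Γ) (lam := lam) α) := by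
  intro f
  obtain ⟨G, hG, hfG⟩ := f.2
  change DifferentiableOn ℂ G (coord '' (varpi g ⁻¹' (absPre Γ U))) at hG
  have hexp : ∀ x (hx : toX Γ x ∈ piPre lam (preY Γ lam U)),
      f.1 ⟨toX Γ x, hx⟩ = laurentEval (laurentCoeff G (varpi g x)) x := fun x hx =>
    (hfG ⟨x, hx⟩).trans (eq_laurentEval_laurentCoeff hG hx)
  let A : LaurentSections lam (absPre Γ U) :=
    ⟨fun r => twist α⁻¹ (laurentCoeff G r), twist_mem_laurent α⁻¹ (laurentCoeff_mem_laurent hG)⟩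
  have hA : A ∈ ncSections Γ lam U := by
    intro γ hγ r hr hr' t
    -- both sides are Laurent expansions of `G` on the torus of radii `r`, since `f` lives on `X`
    have key : laurentCoeff G r =
        fun t => laurentCoeff G (r * (varpi g γ)⁻¹) t * ((monomial t γ)⁻¹ : ℂˣ) := by
      have hm : ∀ x : T g, varpi g x = r → ∀ t,
          laurentCoeff G (r * (varpi g γ)⁻¹) t * ((monomial t γ)⁻¹ : ℂˣ) * (monomial t x : ℂ) =
            laurentCoeff G (varpi g (x * γ⁻¹)) t * (monomial t (x * γ⁻¹) : ℂ) := by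
        rintro x rfl t
        rw [map_mul, map_mul, map_inv, map_inv]
        push_cast
        ring
      refine laurentEval_injective (laurentSummable_laurentCoeff hG hr) ?_ fun x hx => ?_
      · obtain ⟨x, hx⟩ : ∃ x, varpi g x = r := ⟨polarPt r 0, varpi_polarPt r 0⟩
        have hx' : varpi g (x * γ⁻¹) = r * (varpi g γ)⁻¹ := by rw [map_mul, map_inv, hx]
        have h := (laurentSummable_laurentCoeff hG (r := varpi g (x * γ⁻¹))
          (by rw [hx']; exact hr')).norm_eval
        refine h.congr fun t => ?_
        rw [← hm x hx t, norm_mul _ (monomial t x : ℂ), norm_monomial, hx]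
      · have hx' : varpi g (x * γ⁻¹) = r * (varpi g γ)⁻¹ := by rw [map_mul, map_inv, hx]
        have h1 : toX Γ (x * γ⁻¹) = toX Γ x := by
          have : toX Γ γ = 1 := (QuotientGroup.eq_one_iff γ).2 hγ
          rw [map_mul, map_inv, this, inv_one, mul_one]
        have hm1 : toX Γ x ∈ piPre lam (preY Γ lam U) := by
          rw [toX_mem_iff, hx]; exact hr
        have hm2 : toX Γ (x * γ⁻¹) ∈ piPre lam (preY Γ lam U) := by rw [h1]; exact hm1
        have e1 := hexp x hm1
        have e2 := hexp (x * γ⁻¹) hm2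
        have e3 : f.1 ⟨toX Γ (x * γ⁻¹), hm2⟩ = f.1 ⟨toX Γ x, hm1⟩ :=
          congrArg f.1 (Subtype.ext h1)
        rw [e3, e1, hx] at e2
        rw [e2]
        exact tsum_congr fun t => (hm x hx t).symm
    change twist α⁻¹ _ t = twist α⁻¹ _ t * _
    rw [twist, twist, mul_assoc]
    exact congrArg _ (congrFun key t)
  refine ⟨⟨A, hA⟩, OX_ext fun x hx => ?_⟩
  rw [evalX_apply, hexp x hx]
  change laurentEval (twist α (twist α⁻¹ _)) x = _
  rw [twist_inv_twist]

variable {α}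

/-- The isomorphism of algebras of sections over `U`. -/
def evalEquiv (hα : IsCobounding b α) (U : Opens (AbsX Γ)) :
    ncSections Γ lam U ≃ₐ[ℂ] StarSections Γ b (preY Γ lam U) :=
  AlgEquiv.ofBijective (evalHom hα U) ⟨evalX_injective α, evalX_surjective α⟩

/-- The isomorphism of presheaves of algebras given by `evalEquiv`. -/
def presheafIso (hα : IsCobounding b α) :
    ncPresheaf Γ lam ≅
      ((TopCat.Sheaf.pushforward (AlgCat.{0} ℂ) (varpiYHom Γ lam)).obj (starSheaf Γ b)).obj :=
  NatIso.ofComponents (fun U => (evalEquiv hα U.unop).toAlgebraIso) fun {U U'} i => by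
    rfl

end iso

end NCTorus

end

theorem mainTheorem5 (g : ℕ) (Γ : Subgroup (NCTorus.T g)) [DiscreteTopology Γ]
    (hΓ : Nonempty (Γ ≃* Multiplicative (Fin g → ℤ)))
    (lam : NCTorus.UnitaryParameter g) [lam.IsTorsion] (b : NCTorus.BilinearRep lam) :
    Nonempty
      ((TopCat.Sheaf.pushforward (AlgCat.{0} ℂ) (NCTorus.varpiYHom Γ lam)).obj
          (NCTorus.starSheaf Γ b) ≅ NCTorus.ncSheaf Γ lam) := by
  obtain ⟨α, hα⟩ := b.represents
  exact ⟨((fullyFaithfulSheafToPresheaf _ _).preimageIso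
    (X := NCTorus.ncSheaf Γ lam)
    (Y := (TopCat.Sheaf.pushforward (AlgCat.{0} ℂ) (NCTorus.varpiYHom Γ lam)).obj
      (NCTorus.starSheaf Γ b)) (NCTorus.presheafIso hα)).symm⟩
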